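/- Let $f:\mathbb R^d\to\mathbb R^d$ satisfy $f(0)=0$ and, for some $\varepsilon_0>0$, $(\mathbf H_f^{\varepsilon})$ $f$ is $C^1$ on the closed ball $B(0,\varepsilon_0)$ and there is $\lambda_f>0$ with $\langle y,Df(0)y\rangle\le-\lambda_f\|y\|^2$ for all $y\in\mathbb R^d$. Driving noise $(\mathbf H_X)$. Let $\frac13<\alpha<\nu\le\frac12$, $p=\frac1\alpha$, $q=\frac p2$. Let $\Omega$ be the space of paths $\omega:\mathbb R\to T^2_1(\mathbb R^m)=1\oplus\mathbb R^m\oplus(\mathbb R^m\otimes\mathbb R^m)$ with $\omega_0=\mathbf 1$ such that, writing $(1,x_{s,t},\mathbb X_{s,t}):=\omega_s^{-1}\otimes\omega_t$, on each compact interval $x$ is $\alpha$-Hölder and $\mathbb X$ is $2\alpha$-Hölder, i.e. $(x,\mathbb X)$ is an $\alpha$-Hölder rough path. Equip $\Omega$ with the $\sigma$-algebra generated by the evaluations and with the shift $(\theta_h\omega)_t=\omega_h^{-1}\otimes\omega_{h+t}$. The law of the noise is a probability measure $\mathbb P$ on $\Omega$ that is invariant under all $\theta_h$, $h\in\mathbb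 R$ (stationary increments), ergodic for $(\theta_h)_{h\in\mathbb R}$, and such that for every $T>0$ there is $C_{T,\nu}$ with $\mathbb E\big(\|x_{s,t}\|^p+\|\mathbb X_{s,t}\|^q\big)\le C_{T,\nu}|t-s|^{p\nu}$ for $0\le s\le t\le T$. Diffusion coefficient $(\mathbf H_g^{\varepsilon})$. For an $\varepsilon_0>0$, $g\in C^3\big(B(0,\varepsilon_0),\mathcal L(\mathbb R^m,\mathbb R^d)\big)$. For a step size $\Delta>0$ and $t_k=k\Delta$, consider the scheme $$y_{t_{k+1}}=y_{t_k}+f(y_{t_k})\Delta+g(y_{t_k})x_{t_k,t_{k+1}}+Dg(y_{t_k})g(y_{t_k})\mathbb X_{t_k,t_{k+1}},\qquad k\in\mathbb N.$$ A solution is said to exist on the whole half line if it remains in the ball $B(0,\varepsilon_0)$ on which the hypotheses on the coefficients are imposed. Theorem. There is $\Delta_0>0$ depending only on $f$, and for every noise as above there is $C_0>0$ depending only on $f$ and on the law of the noise (in particular neither on $g$, nor on $\varepsilon_0$, nor on $\Delta$), such that the following holds. If $\varepsilon_0>0$ is such that $(\mathbf H_f^{\varepsilon})$ and $(\mathbf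 H_g^{\varepsilon})$ hold in $B(0,\varepsilon_0)$, if $g(0)=0$, $\|Dg(0)\|<C_0$ and $0<\Delta<\Delta_0$, then the trivial solution of the scheme is almost surely exponentially stable, that is: (i) for every $\varepsilon>0$ there is a positive random variable $r(\omega)$ such that, for almost every $\omega$, every solution with $\|y_0\|<r(\omega)$ exists on the whole half line and satisfies $\sup_{k}\|y_{t_k}\|<\varepsilon$; (ii) there are positive random variables $r(\omega),\alpha(\omega)$ and a nonrandom $\mu>0$ such that, for almost every $\omega$, every solution with $\|y_0\|<r(\omega)$ exists on the whole half line and satisfies $\|y_{t_k}\|\le\alpha(\omega)e^{-\mu t_k}$ for all $k\ge0$. -/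

import Mathlib

namespace RoughEuler

open MeasureTheory Set

noncomputable section

/-- The state spaces `ℝ^d`, `ℝ^m`, with the Euclidean norm. -/
abbrev Vec (n : ℕ) : Type := EuclideanSpace ℝ (Fin n)

/-- `ℝ^m ⊗ ℝ^m`, in coordinates. -/
abbrev Ten (m : ℕ) : Type := EuclideanSpace ℝ (Fin m × Fin m)

/-- The elementary tensor `u ⊗ v`. -/
def tensor {m : ℕ} (u v : Vec m) : Ten m := WithLp.toLp 2 fun ij => u ij.1 * v ij.2

@[simp] lemma tensor_apply {m : ℕ} (u v : Vec m) (ij : Fin m × Fin m) :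
    tensor u v ij = u ij.1 * v ij.2 := rfl

/-- The group `T²₁(ℝ^m) = 1 ⊕ ℝ^m ⊕ (ℝ^m ⊗ ℝ^m)` (the constant first entry is not stored). -/
@[ext] structure T2 (m : ℕ) where
  lvl1 : Vec m
  lvl2 : Ten m

/-- The truncated tensor product
`(1, g¹, g²) ⊗ (1, h¹, h²) = (1, g¹ + h¹, g¹ ⊗ h¹ + g² + h²)`, with unit `(1, 0, 0)` and
inverse `(1, -g¹, g¹ ⊗ g¹ - g²)`. -/
instance (m : ℕ) : Group (T2 m) where
  mul g h := ⟨g.lvl1 + h.lvl1, tensor g.lvl1 h.lvl1 + g.lvl2 + h.lvl2⟩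
  one := ⟨0, 0⟩
  inv g := ⟨-g.lvl1, tensor g.lvl1 g.lvl1 - g.lvl2⟩
  mul_assoc a b c := by
    apply T2.ext
    · exact add_assoc _ _ _
    · ext ij
      change (a.lvl1 + b.lvl1) ij.1 * c.lvl1 ij.2 +
          (a.lvl1 ij.1 * b.lvl1 ij.2 + a.lvl2 ij + b.lvl2 ij) + c.lvl2 ij =
        a.lvl1 ij.1 * (b.lvl1 + c.lvl1) ij.2 + a.lvl2 ij +
          (b.lvl1 ij.1 * c.lvl1 ij.2 + b.lvl2 ij + c.lvl2 ij)
      simp only [PiLp.add_apply]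
      ring
  one_mul a := by
    apply T2.ext
    · exact zero_add _
    · ext ij
      change (0 : ℝ) * a.lvl1 ij.2 + 0 + a.lvl2 ij = a.lvl2 ij
      ring
  mul_one a := by
    apply T2.ext
    · exact add_zero _
    · ext ij
      change a.lvl1 ij.1 * (0 : ℝ) + a.lvl2 ij + 0 = a.lvl2 ij
      ring
  inv_mul_cancel a := by
    apply T2.ext
    · exact neg_add_cancel _
    · ext ij
      change (-a.lvl1 ij.1) * a.lvl1 ij.2 + (a.lvl1 ij.1 * a.lvl1 ij.2 - a.lvl2 ij) + a.lvl2 ij = 0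
      ring

/-- The space `Ω` of driving paths: `α`-Hölder rough paths on the whole line, written as paths
`ω : ℝ → T²₁(ℝ^m)` with `ω 0 = 1`.  With `(1, x_{s,t}, 𝕏_{s,t}) = ω_s⁻¹ ⊗ ω_t`, the field `holder`
says that on every compact interval `x` is `α`-Hölder and `𝕏` is `2α`-Hölder; Chen's relation is
the group identity `ω_s⁻¹ ω_t = (ω_s⁻¹ ω_u)(ω_u⁻¹ ω_t)`. -/
structure PathSpace (m : ℕ) (α : ℝ) where
  toFun : ℝ → T2 m
  map_zero : toFun 0 = 1
  holder : ∀ a b : ℝ, ∃ C : ℝ, ∀ s t : ℝ, a ≤ s → s ≤ t → t ≤ b →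
    ‖((toFun s)⁻¹ * toFun t).lvl1‖ ≤ C * (t - s) ^ α ∧
    ‖((toFun s)⁻¹ * toFun t).lvl2‖ ≤ C * (t - s) ^ (2 * α)

variable {m d : ℕ} {α : ℝ}

/-- The increment `x_{s,t} = x_t - x_s` of the first level. -/
def PathSpace.x (ω : PathSpace m α) (s t : ℝ) : Vec m := ((ω.toFun s)⁻¹ * ω.toFun t).lvl1

/-- The second level `𝕏_{s,t}` of the rough path. -/
def PathSpace.XX (ω : PathSpace m α) (s t : ℝ) : Ten m := ((ω.toFun s)⁻¹ * ω.toFun t).lvl2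

lemma PathSpace.x_eq (ω : PathSpace m α) (s t : ℝ) :
    ω.x s t = (ω.toFun t).lvl1 - (ω.toFun s).lvl1 := by
  change -(ω.toFun s).lvl1 + (ω.toFun t).lvl1 = _
  abel

/-- Chen's relation. -/
lemma PathSpace.chen (ω : PathSpace m α) (s u t : ℝ) :
    ω.XX s t - ω.XX s u - ω.XX u t = tensor (ω.x s u) (ω.x u t) := by
  have h : (ω.toFun s)⁻¹ * ω.toFun t =
      ((ω.toFun s)⁻¹ * ω.toFun u) * ((ω.toFun u)⁻¹ * ω.toFun t) := by group
  have h2 : ω.XX s t = tensor (ω.x s u) (ω.x u t) + ω.XX s u + ω.XX u t := congrArg T2.lvl2 h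
  rw [h2]
  abel

/-- The σ-algebra on `Ω` generated by the evaluations `ω ↦ ω_t`. -/
instance : MeasurableSpace (PathSpace m α) :=
  MeasurableSpace.comap
    (fun (ω : PathSpace m α) (t : ℝ) => ((ω.toFun t).lvl1, (ω.toFun t).lvl2)) inferInstance

/-- The Wiener-type shift `(θ_h ω)_t = ω_h⁻¹ ⊗ ω_{h+t}`. -/
def shift (h : ℝ) (ω : PathSpace m α) : PathSpace m α where
  toFun t := (ω.toFun h)⁻¹ * ω.toFun (h + t)
  map_zero := by simp
  holder a b := by
    obtain ⟨C, hC⟩ := ω.holder (h + a) (h + b)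
    refine ⟨C, fun s t hs hst ht => ?_⟩
    have key : ((ω.toFun h)⁻¹ * ω.toFun (h + s))⁻¹ * ((ω.toFun h)⁻¹ * ω.toFun (h + t)) =
        (ω.toFun (h + s))⁻¹ * ω.toFun (h + t) := by group
    have := hC (h + s) (h + t) (by linarith) (by linarith) (by linarith)
    rw [key]
    simpa using this

/-- The hypothesis on the driving noise, for the law `P` of the noise on the path space:
stationary increments, ergodicity of the Wiener-type shift, and the moment bound
`E (‖x_{s,t}‖^p + ‖𝕏_{s,t}‖^(p/2)) ≤ C_T |t - s|^(pν)` with `p = 1/α`. -/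
structure NoiseHyp (ν : ℝ) (P : Measure (PathSpace m α)) : Prop where
  prob : IsProbabilityMeasure P
  stationary : ∀ h : ℝ, MeasurePreserving (shift h) P P
  ergodic : ∀ B : Set (PathSpace m α), MeasurableSet B → (∀ h : ℝ, shift h ⁻¹' B = B) →
    P B = 0 ∨ P B = 1
  moments : ∀ T : ℝ, 0 < T → ∃ C : ℝ, ∀ s t : ℝ, 0 ≤ s → s ≤ t → t ≤ T →
    ∫⁻ ω, (ENNReal.ofReal (‖ω.x s t‖ ^ (1 / α)) + ENNReal.ofReal (‖ω.XX s t‖ ^ (1 / (2 * α)))) ∂P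
      ≤ ENNReal.ofReal (C * (t - s) ^ (1 / α * ν))

/-- The local hypothesis on the drift: `f` is `C¹` on the closed ball `B(0, ε₀)`, and
`Df(0)` is negative definite. -/
structure DriftHyp (ε₀ : ℝ) (f : Vec d → Vec d) : Prop where
  contDiff : ContDiffOn ℝ 1 f (Metric.closedBall 0 ε₀)
  negDef : ∃ lam : ℝ, 0 < lam ∧
    ∀ y : Vec d, inner ℝ y (fderiv ℝ f 0 y) ≤ -lam * ‖y‖ ^ 2

/-- The local hypothesis on the diffusion: `g` is `C³` on the closed ball `B(0, ε₀)`.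
Values of `g` outside the ball are irrelevant. -/
def DiffusionHyp (ε₀ : ℝ) (g : Vec d → Vec m →L[ℝ] Vec d) : Prop :=
  ContDiffOn ℝ 3 g (Metric.closedBall 0 ε₀)

/-- `L(X) = ∑ᵢⱼ X^{ij} L(eᵢ, eⱼ)` with `L(u, v) = Dg(y)[g(y) u] v`, that is, `Dg(y) g(y) X`.  Here
`g` is a function on the ball `B(0, ε₀)` and `Dg` is its derivative there. -/
def secondOrder (ε₀ : ℝ) (g : Vec d → Vec m →L[ℝ] Vec d) (y : Vec d) (X : Ten m) : Vec d :=
  ∑ i : Fin m, ∑ j : Fin m, X (i, j) •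
    (fderivWithin ℝ g (Metric.closedBall 0 ε₀) y (g y (EuclideanSpace.single i 1)))
      (EuclideanSpace.single j 1)

/-- One step of the scheme from time `s` to time `t`:
`y ↦ y + f(y)(t - s) + g(y) x_{s,t} + Dg(y) g(y) 𝕏_{s,t}`. -/
def step (ε₀ : ℝ) (f : Vec d → Vec d) (g : Vec d → Vec m →L[ℝ] Vec d)
    (ω : PathSpace m α) (s t : ℝ) (y : Vec d) : Vec d :=
  y + (t - s) • f y + g y (ω.x s t) + secondOrder ε₀ g y (ω.XX s t)

/-- `y = (y_{t_k})_{k ∈ ℕ}`, `t_k = kΔ`, is the solution of the scheme started at `y₀`, and it exists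
on the whole half line: it never leaves the ball `B(0, ε₀)` on which the coefficients live. -/
structure IsSolution (ε₀ : ℝ) (f : Vec d → Vec d) (g : Vec d → Vec m →L[ℝ] Vec d)
    (Δ : ℝ) (ω : PathSpace m α) (y₀ : Vec d) (y : ℕ → Vec d) : Prop where
  init : y 0 = y₀
  mem : ∀ k, y k ∈ Metric.closedBall (0 : Vec d) ε₀
  recur : ∀ k : ℕ, y (k + 1) = step ε₀ f g ω (k * Δ) ((k + 1 : ℕ) * Δ) (y k)

/-- Almost sure Lyapunov stability of a reference solution `a` of the scheme: for each `ε > 0` there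
is a positive random variable `r` such that solutions started closer than `r(ω)` to `a₀(ω)` exist on
the whole half line and satisfy `sup_k ‖y_{t_k} - a_{t_k}‖ < ε`. -/
def IsStable (P : Measure (PathSpace m α)) (ε₀ : ℝ) (f : Vec d → Vec d)
    (g : Vec d → Vec m →L[ℝ] Vec d) (Δ : ℝ) (a : PathSpace m α → ℕ → Vec d) : Prop :=
  ∀ ε : ℝ, 0 < ε → ∃ r : PathSpace m α → ℝ, Measurable r ∧ (∀ ω, 0 < r ω) ∧
    ∀ᵐ ω ∂P, ∀ y₀ : Vec d, ‖y₀ - a ω 0‖ < r ω →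
      ∃ y : ℕ → Vec d, IsSolution ε₀ f g Δ ω y₀ y ∧ ∃ δ < ε, ∀ k, ‖y k - a ω k‖ ≤ δ

/-- Almost sure exponential stability of a reference solution `a` of the scheme: it is stable, and
there are positive random variables `r`, `A` and a (nonrandom) `μ > 0` such that solutions started
closer than `r(ω)` to `a₀(ω)` exist on the whole half line and satisfy
`‖y_{t_k} - a_{t_k}‖ ≤ A(ω) exp(-μ t_k)`. -/
def IsExpStable (P : Measure (PathSpace m α)) (ε₀ : ℝ) (f : Vec d → Vec d)
    (g : Vec d → Vec m →L[ℝ] Vec d) (Δ : ℝ) (a : PathSpace m α → ℕ → Vec d) : Prop :=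
  IsStable P ε₀ f g Δ a ∧
  ∃ (r A : PathSpace m α → ℝ) (μ : ℝ), Measurable r ∧ Measurable A ∧
    (∀ ω, 0 < r ω) ∧ (∀ ω, 0 < A ω) ∧ 0 < μ ∧
    ∀ᵐ ω ∂P, ∀ y₀ : Vec d, ‖y₀ - a ω 0‖ < r ω →
      ∃ y : ℕ → Vec d, IsSolution ε₀ f g Δ ω y₀ y ∧
        ∀ k : ℕ, ‖y k - a ω k‖ ≤ A ω * Real.exp (-μ * (k * Δ))

end

end RoughEuler

namespace RoughEuler

open MeasureTheory Set Filter
open scoped ENNReal Topology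

/-! ### The weak-type maximal ergodic inequality -/

/-! Time is cut into blocks of `2 ^ k` steps with `1/2 ≤ 2 ^ k Δ ≤ 1`. Over one block the drift
alone contracts the linearized scheme by `exp (-λ/4)` (`norm_one_add_smul_le`). If `‖Dg(0)‖ ≤ δ²`,
the noise changes this at most by a factor `exp (η + K δ (1 + w))`, where `w` is the `dyadicControl`
of the path on a window of length two and `K` depends neither on `Δ` nor on `g`
(`linear_block_bound`).

This uniformity in `Δ` is the core. The control `w` dominates both levels of the rough path by
chaining (`norm_le_control`), has finite mean because `ν > α` (`lintegral_control_lt_top`), and is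
superadditive, so `l ^ κ w` gains `2 ^ (-κ)` when an interval is halved. By Chen's relation and `3α
> 1` the error of the second-order expansion is bounded by this control, and its strict gain lets a
multiplicative sewing argument run on the binary tree of steps (`norm_dyadicProd_sub_le`). Where the
control is large, splitting the tree gives an exponential bound instead (`norm_dyadicProd_le_exp`).

The mean exponent `-λ/4 + η + K δ (1 + E w)` is negative once `δ` is small in terms of `f` and the
law of the noise; `C₀ = δ²`. The nonlinear remainder may be treated crudely, since `Δ` and `g` are
fixed by then: near zero it is `ρ exp (C (1 + w))`. A small `ρ` handles `w ≤ R`, and for large `R`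
the event `w > R` adds little to the mean (`growthRate`).

It remains to average along one path. Only the flow of all real shifts is ergodic; the shift by one
block length need not be. Hence each block borrows a time `v` from the preceding interval of block
length at which the rate is at most twice its time integral (`exists_le_flowInt`). The rates of
successive blocks then sum to at most twice an integral along the flow, which grows linearly with
any slope above the mean (`ae_flowInt_le`); a maximal inequality and the zero-one law suffice for
this. `norm_le_of_block` turns the result into exponential decay, while keeping the orbit where the
linearization is valid. -/

open Classical in
-- Greedy covering: from a point of `B` jump over a stretch whose sum pays `c` per site, from any
-- other point move one site. The last jump overshoots by at most `N`, hence the range `L + N`.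
lemma sum_ite_le_sum_of_stopping (a : ℕ → ℝ≥0∞) (c : ℝ≥0∞) (N : ℕ) (B : ℕ → Prop)
    (hB : ∀ k, B k → ∃ n, 1 ≤ n ∧ n ≤ N ∧ n * c ≤ ∑ i ∈ Finset.range n, a (k + i)) (L : ℕ) :
    ∀ j, ∑ k ∈ Finset.range L, (if B (j + k) then c else 0) ≤
      ∑ k ∈ Finset.range (L + N), a (j + k) := by
  induction L using Nat.strong_induction_on with
  | _ L ih =>
    intro j
    rcases Nat.eq_zero_or_pos L with rfl | hL
    · simp
    by_cases hj : B j
    · obtain ⟨n, hn1, hnN, hn⟩ := hB j hj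
      rcases le_or_gt L n with hLn | hLn
      · calc ∑ k ∈ Finset.range L, (if B (j + k) then c else 0)
            ≤ ∑ k ∈ Finset.range L, c := Finset.sum_le_sum fun k _ => by split_ifs <;> simp
          _ = L * c := by simp
          _ ≤ n * c := by gcongr
          _ ≤ ∑ i ∈ Finset.range n, a (j + i) := hn
          _ ≤ _ := Finset.sum_le_sum_of_subset (Finset.range_mono (by omega))
      · obtain ⟨L', rfl⟩ := Nat.exists_eq_add_of_le hLn.le
        have h1 := ih L' (by omega) (j + n)
        rw [Finset.sum_range_add, add_assoc n L' N, Finset.sum_range_add]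
        simp only [add_assoc] at h1 ⊢
        refine add_le_add ?_ h1
        calc ∑ k ∈ Finset.range n, (if B (j + k) then c else 0)
            ≤ ∑ k ∈ Finset.range n, c := Finset.sum_le_sum fun k _ => by split_ifs <;> simp
          _ = n * c := by simp
          _ ≤ _ := hn
    · obtain ⟨L', rfl⟩ := Nat.exists_eq_add_of_le' hL
      have h1 := ih L' (by omega) (j + 1)
      rw [Finset.sum_range_succ', show L' + 1 + N = L' + N + 1 by ring,
        Finset.sum_range_succ' (fun k => a (j + k))]
      simp only [add_zero, hj, if_false]
      refine le_trans ?_ le_self_add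
      simpa only [add_assoc, add_comm 1] using h1

/-- The weak-type maximal inequality for the Birkhoff sums of a nonnegative function. -/
theorem maximal_ergodic {X : Type*} [MeasurableSpace X] {P : Measure X} [IsProbabilityMeasure P]
    {T : X → X} (hT : MeasurePreserving T P P) {Y : X → ℝ≥0∞} (hY : Measurable Y) (c : ℝ≥0∞)
    (hc : c ≠ ∞) :
    c * P {x | ∃ n : ℕ, n * c < ∑ i ∈ Finset.range n, Y (T^[i] x)} ≤ ∫⁻ x, Y x ∂P := by
  classical
  by_cases hYfin : ∫⁻ x, Y x ∂P = ∞
  · rw [hYfin]; exact le_top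
  set D : ℕ → Set X := fun N => {x | ∃ n, n ≤ N ∧ n * c < ∑ i ∈ Finset.range n, Y (T^[i] x)}
    with hD
  have hTi : ∀ i, MeasurePreserving (T^[i]) P P := fun i => hT.iterate i
  have hDm : ∀ N, MeasurableSet (D N) := by
    intro N
    have : D N = ⋃ n, ⋃ (_ : n ≤ N), {x | n * c < ∑ i ∈ Finset.range n, Y (T^[i] x)} := by
      ext x; simp [hD]
    rw [this]
    refine MeasurableSet.iUnion fun n => MeasurableSet.iUnion fun _ =>
      measurableSet_lt measurable_const ?_
    exact Finset.measurable_fun_sum _ fun i _ => hY.comp (hTi i).measurable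
  have hDmono : Monotone D := fun N N' h x ⟨n, hn, hx⟩ => ⟨n, hn.trans h, hx⟩
  have hU : {x | ∃ n : ℕ, n * c < ∑ i ∈ Finset.range n, Y (T^[i] x)} = ⋃ N, D N := by
    ext x
    simp only [hD, mem_ofPred_eq, mem_iUnion]
    exact ⟨fun ⟨n, hn⟩ => ⟨n, n, le_rfl, hn⟩, fun ⟨_, n, _, hn⟩ => ⟨n, hn⟩⟩
  -- The covering inequality is integrated along an orbit of length `L`; by invariance all terms of
  -- each sum have the same integral.
  have key : ∀ N L : ℕ, L * (c * P (D N)) ≤ (L + N : ℕ) * ∫⁻ x, Y x ∂P := by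
    intro N L
    have hpt : ∀ x, ∑ k ∈ Finset.range L, (if T^[k] x ∈ D N then c else 0) ≤
        ∑ k ∈ Finset.range (L + N), Y (T^[k] x) := by
      intro x
      have := sum_ite_le_sum_of_stopping (fun k => Y (T^[k] x)) c N (fun k => T^[k] x ∈ D N)
        (by
          rintro k ⟨n, hn, hx⟩
          refine ⟨n, ?_, hn, ?_⟩
          · rcases Nat.eq_zero_or_pos n with rfl | h
            · simp at hx
            · exact h
          · refine hx.le.trans (le_of_eq ?_)
            refine Finset.sum_congr rfl fun i _ => ?_
            rw [← Function.iterate_add_apply, add_comm]) L 0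
      simpa using this
    have hint := lintegral_mono (μ := P) hpt
    rw [lintegral_finsetSum', lintegral_finsetSum'] at hint
    · have h1 : ∀ k ∈ Finset.range L, ∫⁻ x, (if T^[k] x ∈ D N then c else 0) ∂P = c * P (D N) := by
        intro k _
        have : (fun x => if T^[k] x ∈ D N then c else 0) =
            fun x => ((D N).indicator (fun _ => c)) (T^[k] x) := by
          ext x; simp [indicator_apply]
        rw [this, (hTi k).lintegral_comp (measurable_const.indicator (hDm N)),
          lintegral_indicator_const (hDm N)]
      have h2 : ∀ k ∈ Finset.range (L + N), ∫⁻ x, Y (T^[k] x) ∂P = ∫⁻ x, Y x ∂P :=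
        fun k _ => (hTi k).lintegral_comp hY
      rw [Finset.sum_congr rfl h1, Finset.sum_congr rfl h2] at hint
      simpa using hint
    · exact fun k _ => (hY.comp (hTi k).measurable).aemeasurable
    · intro k _
      exact (Measurable.ite ((hTi k).measurable (hDm N)) measurable_const
        measurable_const).aemeasurable
  rw [hU, hDmono.measure_iUnion, ENNReal.mul_iSup]
  refine iSup_le fun N => ?_
  set e := ∫⁻ x, Y x ∂P
  have hcD : c * P (D N) ≠ ∞ := ENNReal.mul_ne_top hc (measure_ne_top _ _)
  rw [← ENNReal.toReal_le_toReal hcD hYfin]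
  by_contra! hlt
  -- Such an `L` makes the boundary term `N e` negligible against `L (c P (D N) - e)`.
  obtain ⟨L, hL⟩ := exists_nat_gt (N * e.toReal / ((c * P (D N)).toReal - e.toReal))
  rw [div_lt_iff₀ (sub_pos.2 hlt)] at hL
  have := ENNReal.toReal_mono (by finiteness) (key N L)
  simp only [ENNReal.toReal_mul, ENNReal.toReal_natCast] at this hL
  push_cast at this
  linarith

/-! ### The shift flow on the path space -/

variable {m : ℕ} {α : ℝ}

@[ext] lemma PathSpace.ext {ω ω' : PathSpace m α} (h : ω.toFun = ω'.toFun) : ω = ω' := by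
  cases ω; cases ω'; congr

lemma shift_shift (a b : ℝ) (ω : PathSpace m α) : shift a (shift b ω) = shift (b + a) ω := by
  ext1
  funext t
  change ((ω.toFun b)⁻¹ * ω.toFun (b + a))⁻¹ * ((ω.toFun b)⁻¹ * ω.toFun (b + (a + t))) =
    (ω.toFun (b + a))⁻¹ * ω.toFun (b + a + t)
  rw [add_assoc]
  group

lemma shift_x (h s t : ℝ) (ω : PathSpace m α) : (shift h ω).x s t = ω.x (h + s) (h + t) := by
  have : ((shift h ω).toFun s)⁻¹ * (shift h ω).toFun t =
      (ω.toFun (h + s))⁻¹ * ω.toFun (h + t) := by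
    change ((ω.toFun h)⁻¹ * ω.toFun (h + s))⁻¹ * ((ω.toFun h)⁻¹ * ω.toFun (h + t)) = _
    group
  exact congrArg T2.lvl1 this

lemma shift_XX (h s t : ℝ) (ω : PathSpace m α) : (shift h ω).XX s t = ω.XX (h + s) (h + t) := by
  have : ((shift h ω).toFun s)⁻¹ * (shift h ω).toFun t =
      (ω.toFun (h + s))⁻¹ * ω.toFun (h + t) := by
    change ((ω.toFun h)⁻¹ * ω.toFun (h + s))⁻¹ * ((ω.toFun h)⁻¹ * ω.toFun (h + t)) = _
    group
  exact congrArg T2.lvl2 this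

/-! ### Continuity and joint measurability of the path and of the shift -/

lemma PathSpace.XX_eq (ω : PathSpace m α) (s t : ℝ) :
    ω.XX s t = (ω.toFun t).lvl2 - (ω.toFun s).lvl2 - tensor (ω.toFun s).lvl1 (ω.x s t) := by
  rw [PathSpace.x_eq]
  ext ij
  change -(ω.toFun s).lvl1 ij.1 * (ω.toFun t).lvl1 ij.2 +
    ((ω.toFun s).lvl1 ij.1 * (ω.toFun s).lvl1 ij.2 - (ω.toFun s).lvl2 ij) + (ω.toFun t).lvl2 ij =
    (ω.toFun t).lvl2 ij - (ω.toFun s).lvl2 ij -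
      (ω.toFun s).lvl1 ij.1 * ((ω.toFun t).lvl1 ij.2 - (ω.toFun s).lvl1 ij.2)
  ring

lemma norm_tensor (u v : Vec m) : ‖tensor u v‖ = ‖u‖ * ‖v‖ := by
  rw [EuclideanSpace.norm_eq, EuclideanSpace.norm_eq, EuclideanSpace.norm_eq,
    ← Real.sqrt_mul (by positivity), Fintype.sum_prod_type, Finset.sum_mul_sum]
  simp [mul_pow]

lemma continuous_tensor : Continuous fun p : Vec m × Vec m => tensor p.1 p.2 := by
  unfold tensor
  fun_prop

/-- `holder` speaks of ordered times only; `min` and `max` give the two-sided form needed for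
continuity. -/
lemma PathSpace.exists_holder_bound (ω : PathSpace m α) (a b : ℝ) : ∃ C : ℝ, ∀ s t : ℝ,
    a ≤ s → a ≤ t → s ≤ b → t ≤ b → ‖ω.x (min s t) (max s t)‖ ≤ C * |t - s| ^ α ∧
      ‖ω.XX (min s t) (max s t)‖ ≤ C * |t - s| ^ (2 * α) := by
  obtain ⟨C, hC⟩ := ω.holder a b
  refine ⟨C, fun s t hs ht hs' ht' => ?_⟩
  have := hC (min s t) (max s t) (le_min hs ht) min_le_max (max_le hs' ht')
  rwa [max_sub_min_eq_abs] at this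

lemma tendsto_rpow_abs_sub {β : ℝ} (hβ : 0 < β) (C s : ℝ) :
    Tendsto (fun t : ℝ => C * |t - s| ^ β) (𝓝 s) (𝓝 0) := by
  have : ContinuousAt (fun t : ℝ => C * |t - s| ^ β) s := by
    refine continuousAt_const.mul (ContinuousAt.rpow_const (by fun_prop) (Or.inr hβ.le))
  have h := this.tendsto
  simpa [hβ.ne'] using h

lemma PathSpace.continuous_lvl1 (hα : 0 < α) (ω : PathSpace m α) :
    Continuous fun t => (ω.toFun t).lvl1 := by
  rw [continuous_iff_continuousAt]
  intro s
  obtain ⟨C, hC⟩ := ω.exists_holder_bound (s - 1) (s + 1)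
  rw [ContinuousAt, tendsto_iff_norm_sub_tendsto_zero]
  refine squeeze_zero' (Eventually.of_forall fun _ => norm_nonneg _) ?_
    (tendsto_rpow_abs_sub hα C s)
  filter_upwards [Icc_mem_nhds (show s - 1 < s by linarith) (show s < s + 1 by linarith)]
    with t ht
  refine le_trans (le_of_eq ?_) (hC s t (by linarith) ht.1 (by linarith) ht.2).1
  rw [PathSpace.x_eq]
  rcases le_total s t with h | h
  · simp [h]
  · simp [h, norm_sub_rev]

/-- The increment of the second coordinate is `𝕏` plus a tensor correction by the first coordinate,
and both vanish as the times merge. -/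
lemma PathSpace.continuous_lvl2 (hα : 0 < α) (ω : PathSpace m α) :
    Continuous fun t => (ω.toFun t).lvl2 := by
  rw [continuous_iff_continuousAt]
  intro s
  have h1 := ω.continuous_lvl1 hα
  obtain ⟨C, hC⟩ := ω.exists_holder_bound (s - 1) (s + 1)
  have hXX : Tendsto (fun t => ω.XX (min s t) (max s t)) (𝓝 s) (𝓝 0) := by
    rw [tendsto_zero_iff_norm_tendsto_zero]
    refine squeeze_zero' (Eventually.of_forall fun _ => norm_nonneg _) ?_
      (tendsto_rpow_abs_sub (β := 2 * α) (by linarith) C s)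
    filter_upwards [Icc_mem_nhds (show s - 1 < s by linarith) (show s < s + 1 by linarith)]
      with t ht
    exact (hC s t (by linarith) ht.1 (by linarith) ht.2).2
  have hT : Tendsto (fun t => tensor (ω.toFun (min s t)).lvl1 (ω.x (min s t) (max s t))) (𝓝 s)
      (𝓝 0) := by
    have hc : Continuous fun t => tensor (ω.toFun (min s t)).lvl1 (ω.x (min s t) (max s t)) := by
      simp only [PathSpace.x_eq]
      exact continuous_tensor.comp ((h1.comp (by fun_prop)).prodMk
        ((h1.comp (by fun_prop)).sub (h1.comp (by fun_prop))))
    have := hc.tendsto s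
    simp only [min_self, max_self, PathSpace.x_eq, sub_self] at this
    convert this using 2
    · simp only [PathSpace.x_eq]
    · ext ij; simp
  rw [ContinuousAt, tendsto_iff_norm_sub_tendsto_zero]
  have hsum := (hXX.add hT).norm
  simp only [add_zero, norm_zero] at hsum
  refine hsum.congr fun t => ?_
  rw [PathSpace.XX_eq, sub_add_cancel]
  rcases le_total s t with h | h
  · simp [h]
  · simp [h, norm_sub_rev]

lemma measurable_lvl (t : ℝ) : Measurable fun ω : PathSpace m α =>
    ((ω.toFun t).lvl1, (ω.toFun t).lvl2) :=
  (measurable_pi_apply t).comp (comap_measurable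
    (fun (ω : PathSpace m α) (t : ℝ) => ((ω.toFun t).lvl1, (ω.toFun t).lvl2)))

/-- Continuity in time and measurability of each evaluation give joint measurability, which is what
Tonelli along the flow requires. -/
lemma measurable_lvl1_uncurry (hα : 0 < α) :
    Measurable fun p : ℝ × PathSpace m α => (p.2.toFun p.1).lvl1 :=
  measurable_uncurry_of_continuous_of_measurable (u := fun t (ω : PathSpace m α) =>
    (ω.toFun t).lvl1) (fun ω => ω.continuous_lvl1 hα) fun t => (measurable_lvl t).fst

lemma measurable_lvl2_uncurry (hα : 0 < α) :
    Measurable fun p : ℝ × PathSpace m α => (p.2.toFun p.1).lvl2 :=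
  measurable_uncurry_of_continuous_of_measurable (u := fun t (ω : PathSpace m α) =>
    (ω.toFun t).lvl2) (fun ω => ω.continuous_lvl2 hα) fun t => (measurable_lvl t).snd

lemma measurable_tensor : Measurable fun p : Vec m × Vec m => tensor p.1 p.2 :=
  continuous_tensor.measurable

lemma measurable_x (s t : ℝ) : Measurable fun ω : PathSpace m α => ω.x s t := by
  simp only [PathSpace.x_eq]
  exact (measurable_lvl t).fst.sub (measurable_lvl s).fst

lemma measurable_XX (s t : ℝ) : Measurable fun ω : PathSpace m α => ω.XX s t := by
  simp only [PathSpace.XX_eq]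
  exact ((measurable_lvl t).snd.sub (measurable_lvl s).snd).sub
    (measurable_tensor.comp ((measurable_lvl s).fst.prodMk (measurable_x s t)))

lemma shift_toFun_lvl1 (h t : ℝ) (ω : PathSpace m α) :
    ((shift h ω).toFun t).lvl1 = (ω.toFun (h + t)).lvl1 - (ω.toFun h).lvl1 :=
  ω.x_eq h (h + t)

lemma shift_toFun_lvl2 (h t : ℝ) (ω : PathSpace m α) :
    ((shift h ω).toFun t).lvl2 = (ω.toFun (h + t)).lvl2 - (ω.toFun h).lvl2 -
      tensor (ω.toFun h).lvl1 ((ω.toFun (h + t)).lvl1 - (ω.toFun h).lvl1) := by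
  rw [← PathSpace.x_eq]
  exact ω.XX_eq h (h + t)

lemma measurable_shift_uncurry (hα : 0 < α) :
    Measurable fun p : ℝ × PathSpace m α => shift p.1 p.2 := by
  refine measurable_comap_iff.2 (measurable_pi_lambda _ fun t => ?_)
  have e : Measurable fun p : ℝ × PathSpace m α => ((p.1 + t : ℝ), p.2) :=
    (measurable_fst.add_const t).prodMk measurable_snd
  have a1 := measurable_lvl1_uncurry (m := m) hα
  have b1 := a1.comp e
  have a2 := measurable_lvl2_uncurry (m := m) hα
  have b2 := a2.comp e
  simp only [Function.comp_def, shift_toFun_lvl1, shift_toFun_lvl2]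
  simp only [Function.comp_def] at b1 b2
  exact (b1.sub a1).prodMk ((b2.sub a2).sub (measurable_tensor.comp (a1.prodMk (b1.sub a1))))

lemma shift_iterate (n : ℕ) (ω : PathSpace m α) : (shift 1)^[n] ω = shift (n : ℝ) ω := by
  induction n generalizing ω with
  | zero =>
    ext1
    funext t
    simp [shift, ω.map_zero]
  | succ n ih => rw [Function.iterate_succ_apply, ih, shift_shift]; congr 1; push_cast; ring

/-- The integral of an observable along the flow over the time interval `(a, b]`. -/
noncomputable def flowInt (q : PathSpace m α → ℝ≥0∞) (ω : PathSpace m α) (a b : ℝ) : ℝ≥0∞ :=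
  ∫⁻ v in Ioc a b, q (shift v ω)

/-! ### Time integrals along the flow and their linear growth -/

section Flow

variable {q : PathSpace m α → ℝ≥0∞}

lemma measurable_flowInt (hα : 0 < α) (hq : Measurable q) (a b : ℝ) :
    Measurable fun ω => flowInt q ω a b :=
  Measurable.lintegral_prod_left'
    (f := fun p : ℝ × PathSpace m α => q (shift p.1 p.2)) (hq.comp (measurable_shift_uncurry hα))

lemma flowInt_mono (ω : PathSpace m α) {a b a' b' : ℝ} (ha : a' ≤ a) (hb : b ≤ b') :
    flowInt q ω a b ≤ flowInt q ω a' b' :=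
  lintegral_mono_set (Ioc_subset_Ioc ha hb)

lemma flowInt_add (ω : PathSpace m α) {a b c : ℝ} (hab : a ≤ b) (hbc : b ≤ c) :
    flowInt q ω a c = flowInt q ω a b + flowInt q ω b c := by
  unfold flowInt
  rw [← Ioc_union_Ioc_eq_Ioc hab hbc, lintegral_union measurableSet_Ioc]
  rw [Set.disjoint_left]
  exact fun x hx hx' => absurd hx.2 (not_le.2 hx'.1)

lemma flowInt_shift (u a b : ℝ) (ω : PathSpace m α) :
    flowInt q (shift u ω) a b = flowInt q ω (u + a) (u + b) := by
  unfold flowInt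
  simp only [shift_shift]
  have h := (measurePreserving_add_left (volume : Measure ℝ) u).setLIntegral_comp_emb
    (MeasurableEquiv.addLeft u).measurableEmbedding (fun v => q (shift v ω)) (Ioc a b)
  refine h.trans ?_
  simp [add_comm]

lemma lintegral_flowInt (hα : 0 < α) (hq : Measurable q) {P : Measure (PathSpace m α)}
    [IsProbabilityMeasure P] (hP : ∀ h : ℝ, MeasurePreserving (shift h) P P) (a b : ℝ) :
    ∫⁻ ω, flowInt q ω a b ∂P = ENNReal.ofReal (b - a) * ∫⁻ ω, q ω ∂P := by
  unfold flowInt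
  rw [lintegral_lintegral_swap]
  · simp_rw [(hP _).lintegral_comp hq]
    rw [lintegral_const, mul_comm]
    simp
  · have := (hq.comp (measurable_shift_uncurry hα)).comp
      (measurable_swap (α := PathSpace m α) (β := ℝ))
    exact this.aemeasurable

lemma sum_flowInt (ω : PathSpace m α) (n : ℕ) :
    ∑ i ∈ Finset.range n, flowInt q ω i (i + 1) = flowInt q ω 0 n := by
  induction n with
  | zero => simp [flowInt]
  | succ n ih =>
    rw [Finset.sum_range_succ, ih, ← flowInt_add ω (by positivity) (by simp)]
    push_cast; rfl

/-- Along an ergodic flow the integrals of a nonnegative observable grow at most linearly, with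
any rate larger than the mean. -/
theorem ae_flowInt_le (hα : 0 < α) {ν : ℝ} {P : Measure (PathSpace m α)} (hP : NoiseHyp ν P)
    (hq : Measurable q) {c : ℝ} (hc : 0 < c) (hqc : ∫⁻ ω, q ω ∂P < ENNReal.ofReal c) :
    ∀ᵐ ω ∂P, ∀ s : ℕ, ∃ K : ℕ, ∀ n : ℕ, flowInt q ω (-s) n ≤ K + ENNReal.ofReal (c * n) := by
  have := hP.prob
  -- Quantifying over every left endpoint `-s` and leaving `K` free makes `A` exactly invariant
  -- under every real shift, as `NoiseHyp.ergodic` demands.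
  set A : Set (PathSpace m α) :=
    {ω | ∀ s : ℕ, ∃ K : ℕ, ∀ n : ℕ, flowInt q ω (-s) n ≤ K + ENNReal.ofReal (c * n)} with hA
  have hAm : MeasurableSet A := by
    simp only [hA, ofPred_forall, ofPred_exists]
    exact MeasurableSet.iInter fun s => MeasurableSet.iUnion fun K => MeasurableSet.iInter fun n =>
      measurableSet_le (measurable_flowInt hα hq _ _) measurable_const
  have hsub : ∀ (h : ℝ) (ω : PathSpace m α), ω ∈ A → shift h ω ∈ A := by
    intro h ω hω s
    obtain ⟨s', hs'⟩ := exists_nat_ge ((s : ℝ) - h)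
    obtain ⟨k, hk⟩ := exists_nat_ge h
    obtain ⟨l, hl⟩ := exists_nat_ge (c * k)
    obtain ⟨K, hK⟩ := hω s'
    refine ⟨K + l, fun n => ?_⟩
    rw [flowInt_shift]
    calc flowInt q ω (h + -s) (h + n) ≤ flowInt q ω (-s') ((n + k : ℕ) : ℝ) :=
          flowInt_mono ω (by linarith) (by push_cast; linarith)
      _ ≤ K + ENNReal.ofReal (c * ((n + k : ℕ) : ℝ)) := hK _
      _ ≤ K + ENNReal.ofReal (l + c * n) := by
          gcongr
          push_cast
          linarith
      _ = _ := by
          rw [ENNReal.ofReal_add (by positivity) (by positivity)]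
          push_cast
          rw [ENNReal.ofReal_natCast, add_assoc]
  have hinv : ∀ h : ℝ, shift h ⁻¹' A = A := by
    intro h
    refine Subset.antisymm (fun ω hω => ?_) (fun ω hω => hsub h ω hω)
    have h1 := hsub (-h) _ hω
    rw [shift_shift, add_neg_cancel] at h1
    have h0 : shift 0 ω = ω := by simpa using (shift_iterate 0 ω).symm
    rwa [h0] at h1
  have hpos : P A ≠ 0 := by
    intro h0
    -- Off `A`, and where the past integrals are finite, some unit-time sum exceeds `c n`. If this
    -- held almost surely, the maximal inequality would force `c` to be at most the mean of `q`.
    set B : Set (PathSpace m α) := {ω | ∃ n : ℕ, n * ENNReal.ofReal c <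
      ∑ i ∈ Finset.range n, flowInt q ((shift 1)^[i] ω) 0 1} with hB
    have hmax := maximal_ergodic (hP.stationary 1) (measurable_flowInt hα hq 0 1)
      (ENNReal.ofReal c) ENNReal.ofReal_ne_top
    rw [lintegral_flowInt hα hq hP.stationary] at hmax
    simp only [sub_zero, ENNReal.ofReal_one, one_mul] at hmax
    have hfin : ∀ᵐ ω ∂P, ∀ s : ℕ, flowInt q ω (-s) 0 < ∞ := by
      rw [ae_all_iff]
      intro s
      refine ae_lt_top (measurable_flowInt hα hq _ _) ?_
      rw [lintegral_flowInt hα hq hP.stationary]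
      exact ENNReal.mul_ne_top ENNReal.ofReal_ne_top hqc.ne_top
    have hAB : ∀ᵐ ω ∂P, ω ∈ B := by
      have hA0 : ∀ᵐ ω ∂P, ω ∉ A := measure_eq_zero_iff_ae_notMem.1 h0
      filter_upwards [hfin, hA0] with ω hω hωA
      by_contra hωB
      refine hωA fun s => ?_
      obtain ⟨K, hK⟩ := ENNReal.exists_nat_gt (hω s).ne
      refine ⟨K, fun n => ?_⟩
      rw [flowInt_add ω (b := 0) (by simp) (by positivity)]
      refine add_le_add hK.le ?_
      simp only [hB, mem_ofPred_eq, not_exists, not_lt] at hωB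
      have := hωB n
      simp only [shift_iterate, flowInt_shift, add_zero, sum_flowInt] at this
      refine this.trans (le_of_eq ?_)
      rw [mul_comm c, ENNReal.ofReal_mul (by positivity), ENNReal.ofReal_natCast]
    have hB1 : P B = 1 := by
      rw [← measure_univ (μ := P)]
      exact measure_congr (eventuallyEq_univ.2 hAB)
    rw [hB1, mul_one] at hmax
    exact absurd hqc (not_lt.2 hmax)
  have h1 : P A = 1 := (hP.ergodic A hAm hinv).resolve_left hpos
  have := (prob_compl_eq_zero_iff hAm).2 h1
  exact (measure_eq_zero_iff_ae_notMem.1 this).mono fun ω hω => not_not.1 hω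

end Flow

/-! ### Dyadic chaining -/

@[simp] lemma PathSpace.x_self (ω : PathSpace m α) (s : ℝ) : ω.x s s = 0 := by
  simp [PathSpace.x_eq]

@[simp] lemma PathSpace.XX_self (ω : PathSpace m α) (s : ℝ) : ω.XX s s = 0 := by
  rw [PathSpace.XX_eq, PathSpace.x_self]
  ext ij
  simp

lemma PathSpace.x_add (ω : PathSpace m α) (s u t : ℝ) : ω.x s t = ω.x s u + ω.x u t := by
  simp only [PathSpace.x_eq]; abel

lemma PathSpace.XX_add (ω : PathSpace m α) (s u t : ℝ) :
    ω.XX s t = ω.XX s u + ω.XX u t + tensor (ω.x s u) (ω.x u t) := by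
  rw [← ω.chen s u t]; abel

lemma tendsto_norm_x (hα : 0 < α) (ω : PathSpace m α) {a b : ℕ → ℝ} {s t : ℝ}
    (ha : Tendsto a atTop (𝓝 s)) (hb : Tendsto b atTop (𝓝 t)) :
    Tendsto (fun k => ‖ω.x (a k) (b k)‖) atTop (𝓝 ‖ω.x s t‖) := by
  simp only [PathSpace.x_eq]
  have h := ω.continuous_lvl1 hα
  exact (((h.tendsto t).comp hb).sub ((h.tendsto s).comp ha)).norm

lemma tendsto_norm_XX (hα : 0 < α) (ω : PathSpace m α) {a b : ℕ → ℝ} {s t : ℝ}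
    (ha : Tendsto a atTop (𝓝 s)) (hb : Tendsto b atTop (𝓝 t)) :
    Tendsto (fun k => ‖ω.XX (a k) (b k)‖) atTop (𝓝 ‖ω.XX s t‖) := by
  simp only [PathSpace.XX_eq, PathSpace.x_eq]
  have h1 := ω.continuous_lvl1 hα
  have h2 := ω.continuous_lvl2 hα
  have h3 : Continuous fun p : ℝ × ℝ => tensor (ω.toFun p.1).lvl1
      ((ω.toFun p.2).lvl1 - (ω.toFun p.1).lvl1) :=
    continuous_tensor.comp ((h1.comp continuous_fst).prodMk
      ((h1.comp continuous_snd).sub (h1.comp continuous_fst)))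
  have h4 := (h3.tendsto (s, t)).comp (ha.prodMk_nhds hb)
  exact ((((h2.tendsto t).comp hb).sub ((h2.tendsto s).comp ha)).sub h4).norm

/-- The smallest point of the dyadic mesh of level `n` that is not below `s`. -/
noncomputable def dyadicCeil (n : ℕ) (s : ℝ) : ℝ := (⌈s * 2 ^ n⌉₊ : ℝ) / 2 ^ n

/-- The largest point of the dyadic mesh of level `n` that is not above `t`. -/
noncomputable def dyadicFloor (n : ℕ) (t : ℝ) : ℝ := (⌊t * 2 ^ n⌋₊ : ℝ) / 2 ^ n

lemma le_dyadicCeil (n : ℕ) (s : ℝ) : s ≤ dyadicCeil n s := by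
  rw [dyadicCeil, le_div_iff₀ (by positivity)]; exact Nat.le_ceil _

lemma dyadicFloor_le (n : ℕ) {t : ℝ} (ht : 0 ≤ t) : dyadicFloor n t ≤ t := by
  rw [dyadicFloor, div_le_iff₀ (by positivity)]; exact Nat.floor_le (by positivity)

lemma dyadicCeil_le_dyadicFloor {n : ℕ} {s t : ℝ} (hs : 0 ≤ s) (h : 1 ≤ (t - s) * 2 ^ n) :
    dyadicCeil n s ≤ dyadicFloor n t := by
  unfold dyadicCeil dyadicFloor
  gcongr
  apply Nat.le_floor
  have := Nat.ceil_lt_add_one (show 0 ≤ s * 2 ^ n by positivity)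
  linarith

lemma tendsto_two_pow : Tendsto (fun n : ℕ => (2 : ℝ) ^ n) atTop atTop :=
  tendsto_pow_atTop_atTop_of_one_lt one_lt_two

lemma tendsto_dyadicCeil {s : ℝ} (hs : 0 ≤ s) :
    Tendsto (fun n => dyadicCeil n s) atTop (𝓝 s) :=
  (tendsto_nat_ceil_mul_div_atTop hs).comp tendsto_two_pow

lemma tendsto_dyadicFloor {s : ℝ} (hs : 0 ≤ s) :
    Tendsto (fun n => dyadicFloor n s) atTop (𝓝 s) :=
  (tendsto_nat_floor_mul_div_atTop hs).comp tendsto_two_pow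

/-- Refining the mesh by one level adds at most one dyadic interval at this end, and likewise at the
other by `dyadicFloor_succ`; the chaining sums are therefore geometric. -/
lemma dyadicCeil_succ (n : ℕ) {s : ℝ} (hs : 0 ≤ s) :
    dyadicCeil (n + 1) s = dyadicCeil n s ∨
      ∃ j : ℕ, dyadicCeil (n + 1) s = j / 2 ^ (n + 1) ∧
        dyadicCeil n s = (j + 1) / 2 ^ (n + 1) := by
  have h1 : ⌈s * 2 ^ (n + 1)⌉₊ ≤ 2 * ⌈s * 2 ^ n⌉₊ := by
    rw [Nat.ceil_le]
    have := Nat.le_ceil (s * 2 ^ n)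
    push_cast
    rw [pow_succ]
    linarith
  have h2 : 2 * ⌈s * 2 ^ n⌉₊ ≤ ⌈s * 2 ^ (n + 1)⌉₊ + 1 := by
    have h3 := Nat.ceil_lt_add_one (show 0 ≤ s * 2 ^ n by positivity)
    have h4 := Nat.le_ceil (s * 2 ^ (n + 1))
    rw [pow_succ] at h4
    have : (2 * ⌈s * 2 ^ n⌉₊ : ℝ) < ⌈s * 2 ^ (n + 1)⌉₊ + 2 := by rw [pow_succ]; linarith
    have : 2 * ⌈s * 2 ^ n⌉₊ < ⌈s * 2 ^ (n + 1)⌉₊ + 2 := by exact_mod_cast this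
    omega
  have key : ∀ a : ℝ, a / 2 ^ n = 2 * a / 2 ^ (n + 1) := fun a => by
    rw [pow_succ]; field_simp
  rcases (show ⌈s * 2 ^ (n + 1)⌉₊ = 2 * ⌈s * 2 ^ n⌉₊ ∨
    2 * ⌈s * 2 ^ n⌉₊ = ⌈s * 2 ^ (n + 1)⌉₊ + 1 by omega) with h | h
  · left
    unfold dyadicCeil
    rw [h, key]; push_cast; rfl
  · right
    refine ⟨_, rfl, ?_⟩
    unfold dyadicCeil
    rw [key]
    congr 1
    exact_mod_cast h

lemma dyadicFloor_succ (n : ℕ) {t : ℝ} (ht : 0 ≤ t) :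
    dyadicFloor (n + 1) t = dyadicFloor n t ∨
      ∃ j : ℕ, dyadicFloor n t = j / 2 ^ (n + 1) ∧
        dyadicFloor (n + 1) t = (j + 1) / 2 ^ (n + 1) := by
  have h1 : 2 * ⌊t * 2 ^ n⌋₊ ≤ ⌊t * 2 ^ (n + 1)⌋₊ := by
    apply Nat.le_floor
    have := Nat.floor_le (show 0 ≤ t * 2 ^ n by positivity)
    push_cast
    rw [pow_succ]
    linarith
  have h2 : ⌊t * 2 ^ (n + 1)⌋₊ ≤ 2 * ⌊t * 2 ^ n⌋₊ + 1 := by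
    have h3 := Nat.lt_floor_add_one (t * 2 ^ n)
    have h4 := Nat.floor_le (show 0 ≤ t * 2 ^ (n + 1) by positivity)
    rw [pow_succ] at h4
    have : (⌊t * 2 ^ (n + 1)⌋₊ : ℝ) < 2 * ⌊t * 2 ^ n⌋₊ + 2 := by rw [pow_succ]; linarith
    have : ⌊t * 2 ^ (n + 1)⌋₊ < 2 * ⌊t * 2 ^ n⌋₊ + 2 := by exact_mod_cast this
    omega
  have key : ∀ a : ℝ, a / 2 ^ n = 2 * a / 2 ^ (n + 1) := fun a => by
    rw [pow_succ]; field_simp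
  rcases (show ⌊t * 2 ^ (n + 1)⌋₊ = 2 * ⌊t * 2 ^ n⌋₊ ∨
    ⌊t * 2 ^ (n + 1)⌋₊ = 2 * ⌊t * 2 ^ n⌋₊ + 1 by omega) with h | h
  · left
    unfold dyadicFloor
    rw [h, key]; push_cast; rfl
  · right
    refine ⟨2 * ⌊t * 2 ^ n⌋₊, ?_, ?_⟩
    · unfold dyadicFloor
      rw [key]; push_cast; rfl
    · unfold dyadicFloor
      rw [h]; push_cast; rfl

/-- Chaining: if the increments of the path over the dyadic subintervals of `[s, t]` decay
geometrically in the level, then so do the increments over `[s, t]` itself. -/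
theorem norm_le_of_dyadic (hα : 0 < α) {ρ : ℝ} (hρ0 : 0 < ρ) (hρ1 : ρ < 1) :
    ∃ C : ℝ, 0 < C ∧ ∀ (ω : PathSpace m α) (s t D : ℝ) (n₀ : ℕ), 0 ≤ s → 0 ≤ D →
      1 ≤ (t - s) * 2 ^ n₀ → (t - s) * 2 ^ n₀ < 2 →
      (∀ n j : ℕ, s ≤ j / 2 ^ n → (j + 1) / 2 ^ n ≤ t →
        ‖ω.x (j / 2 ^ n) ((j + 1) / 2 ^ n)‖ ≤ ρ ^ n * D ∧
        ‖ω.XX (j / 2 ^ n) ((j + 1) / 2 ^ n)‖ ≤ (ρ ^ n * D) ^ 2) →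
      ‖ω.x s t‖ ≤ C * (ρ ^ n₀ * D) ∧ ‖ω.XX s t‖ ≤ C * (ρ ^ n₀ * D) ^ 2 := by
  -- A new level contributes two first-order increments, at most `2 E ρ ^ (k + 1)`, and the bound `E
  -- (1 + c - c ρ ^ k)` grows by `2 E ρ ^ k`.
  set c := 2 / (1 - ρ) with hc
  have hρ' : 0 < 1 - ρ := by linarith
  have hc0 : 0 < c := by positivity
  have hcρ : c * (1 - ρ) = 2 := by rw [hc]; field_simp
  -- The numerator counts the second-order contributions of a level: two for the end intervals, `1 +
  -- c` and `2 + c` for the two tensor terms of Chen's relation.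
  set c2 := (2 * c + 5) / (1 - ρ) with hc2
  have hc20 : 0 < c2 := by positivity
  have hc2ρ : c2 * (1 - ρ) = 2 * c + 5 := by rw [hc2]; field_simp
  refine ⟨1 + c + c2, by positivity, fun ω s t D n₀ hs hD hst1 hst2 H => ?_⟩
  have ht : 0 ≤ t := by
    by_contra! h
    have : (t - s) * 2 ^ n₀ ≤ 0 := mul_nonpos_of_nonpos_of_nonneg (by linarith) (by positivity)
    linarith
  have hts : 0 ≤ t - s := by
    by_contra! h
    have : (t - s) * 2 ^ n₀ ≤ 0 := mul_nonpos_of_nonpos_of_nonneg h.le (by positivity)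
    linarith
  set E := ρ ^ n₀ * D with hE
  have hE0 : 0 ≤ E := by positivity
  have hEk : ∀ k, ρ ^ (n₀ + k) * D = E * ρ ^ k := fun k => by rw [pow_add, hE]; ring
  have hle : ∀ k, dyadicCeil (n₀ + k) s ≤ dyadicFloor (n₀ + k) t := fun k => by
    refine dyadicCeil_le_dyadicFloor hs (hst1.trans ?_)
    gcongr
    · norm_num
    · omega
  have hleft : ∀ k, ‖ω.x (dyadicCeil (n₀ + k + 1) s) (dyadicCeil (n₀ + k) s)‖ ≤ E * ρ ^ (k + 1) ∧
      ‖ω.XX (dyadicCeil (n₀ + k + 1) s) (dyadicCeil (n₀ + k) s)‖ ≤ (E * ρ ^ (k + 1)) ^ 2 := by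
    intro k
    rcases dyadicCeil_succ (n₀ + k) hs with h | ⟨j, h1, h2⟩
    · rw [h]; simp only [PathSpace.x_self, PathSpace.XX_self, norm_zero]
      constructor <;> positivity
    · have := H (n₀ + k + 1) j (h1 ▸ le_dyadicCeil _ _)
        (h2 ▸ (hle k).trans (dyadicFloor_le _ ht))
      rwa [← h1, ← h2, add_assoc n₀ k 1, hEk] at this
  have hright : ∀ k, ‖ω.x (dyadicFloor (n₀ + k) t) (dyadicFloor (n₀ + k + 1) t)‖ ≤
      E * ρ ^ (k + 1) ∧
      ‖ω.XX (dyadicFloor (n₀ + k) t) (dyadicFloor (n₀ + k + 1) t)‖ ≤ (E * ρ ^ (k + 1)) ^ 2 := by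
    intro k
    rcases dyadicFloor_succ (n₀ + k) ht with h | ⟨j, h1, h2⟩
    · rw [h]; simp only [PathSpace.x_self, PathSpace.XX_self, norm_zero]
      constructor <;> positivity
    · have := H (n₀ + k + 1) j (h1 ▸ (le_dyadicCeil _ _).trans (hle k))
        (h2 ▸ dyadicFloor_le _ ht)
      rwa [← h1, ← h2, add_assoc n₀ k 1, hEk] at this
  -- Since `t - s` is less than two meshes of level `n₀`, the two mesh points coincide or are
  -- adjacent.
  have hzero : ‖ω.x (dyadicCeil n₀ s) (dyadicFloor n₀ t)‖ ≤ E ∧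
      ‖ω.XX (dyadicCeil n₀ s) (dyadicFloor n₀ t)‖ ≤ E ^ 2 := by
    have h1 : dyadicCeil n₀ s ≤ dyadicFloor n₀ t := hle 0
    have h2 : ⌊t * 2 ^ n₀⌋₊ < ⌈s * 2 ^ n₀⌉₊ + 2 := by
      have h3 := Nat.floor_le (show 0 ≤ t * 2 ^ n₀ by positivity)
      have h4 := Nat.le_ceil (s * 2 ^ n₀)
      have : (⌊t * 2 ^ n₀⌋₊ : ℝ) < ⌈s * 2 ^ n₀⌉₊ + 2 := by linarith
      exact_mod_cast this
    have h3 : ⌈s * 2 ^ n₀⌉₊ ≤ ⌊t * 2 ^ n₀⌋₊ := by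
      unfold dyadicCeil dyadicFloor at h1
      rw [div_le_div_iff_of_pos_right (by positivity)] at h1
      exact_mod_cast h1
    rcases (show ⌊t * 2 ^ n₀⌋₊ = ⌈s * 2 ^ n₀⌉₊ ∨ ⌊t * 2 ^ n₀⌋₊ = ⌈s * 2 ^ n₀⌉₊ + 1 by omega)
      with h | h
    · have : dyadicFloor n₀ t = dyadicCeil n₀ s := by unfold dyadicCeil dyadicFloor; rw [h]
      rw [this]; simp only [PathSpace.x_self, PathSpace.XX_self, norm_zero]
      constructor <;> positivity
    · have e : dyadicFloor n₀ t = ((⌈s * 2 ^ n₀⌉₊ : ℝ) + 1) / 2 ^ n₀ := by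
        unfold dyadicFloor; rw [h]; push_cast; rfl
      have := H n₀ ⌈s * 2 ^ n₀⌉₊ (le_dyadicCeil _ _) (e ▸ dyadicFloor_le _ ht)
      rwa [← e] at this
  have hρk : ∀ k : ℕ, 0 ≤ ρ ^ k ∧ ρ ^ k ≤ 1 := fun k =>
    ⟨by positivity, pow_le_one₀ hρ0.le hρ1.le⟩
  have hx : ∀ k, ‖ω.x (dyadicCeil (n₀ + k) s) (dyadicFloor (n₀ + k) t)‖ ≤
      E * (1 + c - c * ρ ^ k) := by
    intro k
    induction k with
    | zero => simpa using hzero.1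
    | succ k ih =>
      rw [ω.x_add _ (dyadicCeil (n₀ + k) s) _, ω.x_add (dyadicCeil (n₀ + k) s)
        (dyadicFloor (n₀ + k) t)]
      calc _ ≤ _ + (_ + _) := (norm_add_le _ _).trans (add_le_add le_rfl (norm_add_le _ _))
        _ ≤ E * ρ ^ (k + 1) + (E * (1 + c - c * ρ ^ k) + E * ρ ^ (k + 1)) :=
          add_le_add (hleft k).1 (add_le_add ih (hright k).1)
        _ ≤ _ := by
          have : 0 ≤ E * (ρ ^ k * (1 - ρ)) := mul_nonneg hE0 (mul_nonneg (hρk k).1 hρ'.le)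
          have h2 : E * (1 + c - c * ρ ^ (k + 1)) -
              (E * ρ ^ (k + 1) + (E * (1 + c - c * ρ ^ k) + E * ρ ^ (k + 1))) =
              E * ρ ^ k * (c * (1 - ρ) - 2 * ρ) := by rw [pow_succ]; ring
          rw [hcρ] at h2
          linarith
  have hx' : ∀ k, ‖ω.x (dyadicCeil (n₀ + k) s) (dyadicFloor (n₀ + k) t)‖ ≤ E * (1 + c) :=
    fun k => (hx k).trans (by
      have := (hρk k).1
      gcongr
      have := mul_nonneg hc0.le this
      linarith)
  have hXX : ∀ k, ‖ω.XX (dyadicCeil (n₀ + k) s) (dyadicFloor (n₀ + k) t)‖ ≤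
      E ^ 2 * (1 + c2 - c2 * ρ ^ k) := by
    intro k
    induction k with
    | zero => simpa using hzero.2
    | succ k ih =>
      rw [ω.XX_add _ (dyadicCeil (n₀ + k) s) _, ω.XX_add (dyadicCeil (n₀ + k) s)
        (dyadicFloor (n₀ + k) t), ω.x_add (dyadicCeil (n₀ + k) s) (dyadicFloor (n₀ + k) t)
        (dyadicFloor (n₀ + (k + 1)) t)]
      have hr : ρ ^ (k + 1) ≤ 1 := (hρk _).2
      have hr0 : 0 ≤ ρ ^ (k + 1) := (hρk _).1
      have hsq : (E * ρ ^ (k + 1)) ^ 2 ≤ E ^ 2 * ρ ^ (k + 1) := by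
        rw [mul_pow, sq (ρ ^ (k + 1))]
        gcongr
        exact mul_le_of_le_one_left hr0 hr
      have hA := (hleft k).2.trans hsq
      have hB := (hright k).2.trans hsq
      have hT1 : ‖tensor (ω.x (dyadicCeil (n₀ + k) s) (dyadicFloor (n₀ + k) t))
          (ω.x (dyadicFloor (n₀ + k) t) (dyadicFloor (n₀ + (k + 1)) t))‖ ≤
          E * (1 + c) * (E * ρ ^ (k + 1)) := by
        rw [norm_tensor]
        exact mul_le_mul (hx' k) (hright k).1 (norm_nonneg _) (by positivity)
      have hT2 : ‖tensor (ω.x (dyadicCeil (n₀ + (k + 1)) s) (dyadicCeil (n₀ + k) s))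
          (ω.x (dyadicCeil (n₀ + k) s) (dyadicFloor (n₀ + k) t) +
            ω.x (dyadicFloor (n₀ + k) t) (dyadicFloor (n₀ + (k + 1)) t))‖ ≤
          E * ρ ^ (k + 1) * (E * (1 + c) + E * 1) := by
        rw [norm_tensor]
        refine mul_le_mul (hleft k).1 ((norm_add_le _ _).trans (add_le_add (hx' k)
          ((hright k).1.trans ?_))) (norm_nonneg _) (by positivity)
        gcongr
      refine (norm_add_le _ _).trans ((add_le_add ((norm_add_le _ _).trans (add_le_add hA
        ((norm_add_le _ _).trans (add_le_add ((norm_add_le _ _).trans (add_le_add ih hB)) hT1))))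
        hT2).trans ?_)
      have h2 : E ^ 2 * (1 + c2 - c2 * ρ ^ (k + 1)) - (E ^ 2 * ρ ^ (k + 1) +
          (E ^ 2 * (1 + c2 - c2 * ρ ^ k) + E ^ 2 * ρ ^ (k + 1) +
            E * (1 + c) * (E * ρ ^ (k + 1))) + E * ρ ^ (k + 1) * (E * (1 + c) + E * 1)) =
          E ^ 2 * ρ ^ k * (c2 * (1 - ρ) - (2 * c + 5) * ρ) := by rw [pow_succ]; ring
      rw [hc2ρ] at h2
      have : 0 ≤ E ^ 2 * ρ ^ k * ((2 * c + 5) * (1 - ρ)) := by positivity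
      linarith
  have hk : Tendsto (fun k => n₀ + k) atTop atTop :=
    tendsto_atTop_mono (fun k => Nat.le_add_left k n₀) tendsto_id
  have hlims : Tendsto (fun k => dyadicCeil (n₀ + k) s) atTop (𝓝 s) :=
    (tendsto_dyadicCeil hs).comp hk
  have hlimt : Tendsto (fun k => dyadicFloor (n₀ + k) t) atTop (𝓝 t) :=
    (tendsto_dyadicFloor ht).comp hk
  constructor
  · refine le_of_tendsto (tendsto_norm_x hα ω hlims hlimt)
      (Eventually.of_forall fun k => (hx' k).trans ?_)
    rw [mul_comm]
    exact mul_le_mul_of_nonneg_right (by linarith) hE0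
  · refine le_of_tendsto (tendsto_norm_XX hα ω hlims hlimt)
      (Eventually.of_forall fun k => (hXX k).trans ?_)
    rw [mul_comm]
    have := mul_nonneg hc20.le (hρk k).1
    exact mul_le_mul_of_nonneg_right (by linarith) (by positivity)

/-! ### The dyadic control -/

/-- The size of the increments of the rough path over `[s, t]`. -/
noncomputable def incr (ω : PathSpace m α) (s t : ℝ) : ℝ≥0∞ :=
  ENNReal.ofReal (‖ω.x s t‖ ^ (1 / α)) + ENNReal.ofReal (‖ω.XX s t‖ ^ (1 / (2 * α)))

/-- The sum of the increments over the dyadic subintervals of `[s, t]`, with the weight `2 ^ (κ n)`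
at level `n`. -/
noncomputable def dyadicControl (κ : ℝ) (ω : PathSpace m α) (s t : ℝ) : ℝ≥0∞ :=
  ∑' I : ℕ × ℕ, if s ≤ (I.2 : ℝ) / 2 ^ I.1 ∧ ((I.2 : ℝ) + 1) / 2 ^ I.1 ≤ t then
    ENNReal.ofReal (2 ^ (κ * I.1)) * incr ω (I.2 / 2 ^ I.1) ((I.2 + 1) / 2 ^ I.1) else 0

lemma measurable_incr (s t : ℝ) : Measurable fun ω : PathSpace m α => incr ω s t :=
  (((measurable_x s t).norm.pow_const _).ennreal_ofReal).add
    (((measurable_XX s t).norm.pow_const _).ennreal_ofReal)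

lemma measurable_control (κ s t : ℝ) :
    Measurable fun ω : PathSpace m α => dyadicControl κ ω s t := by
  refine Measurable.tsum fun I => ?_
  split_ifs
  · exact (measurable_incr _ _).const_mul _
  · exact measurable_const

lemma control_mono (κ : ℝ) (ω : PathSpace m α) {s t s' t' : ℝ} (hs : s' ≤ s) (ht : t ≤ t') :
    dyadicControl κ ω s t ≤ dyadicControl κ ω s' t' := by
  refine ENNReal.tsum_le_tsum fun I => ?_
  split_ifs with h1 h2
  · exact le_rfl
  · exact absurd ⟨hs.trans h1.1, h1.2.trans ht⟩ h2
  · exact zero_le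
  · exact le_rfl

/-- A dyadic interval contained in `[s, u]` is not contained in `[u, t]`, so no term is counted
twice; those straddling `u` are lost. -/
lemma control_add_le (κ : ℝ) (ω : PathSpace m α) {s u t : ℝ} (hsu : s ≤ u) (hut : u ≤ t) :
    dyadicControl κ ω s u + dyadicControl κ ω u t ≤ dyadicControl κ ω s t := by
  unfold dyadicControl
  rw [← ENNReal.tsum_add]
  refine ENNReal.tsum_le_tsum fun I => ?_
  by_cases h1 : s ≤ (I.2 : ℝ) / 2 ^ I.1 ∧ ((I.2 : ℝ) + 1) / 2 ^ I.1 ≤ u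
  · have h2 : ¬ (u ≤ (I.2 : ℝ) / 2 ^ I.1 ∧ ((I.2 : ℝ) + 1) / 2 ^ I.1 ≤ t) := by
      rintro ⟨h, -⟩
      have : (I.2 : ℝ) / 2 ^ I.1 < ((I.2 : ℝ) + 1) / 2 ^ I.1 := by gcongr; linarith
      linarith [h1.2]
    rw [if_pos h1, if_neg h2, if_pos ⟨h1.1, h1.2.trans hut⟩, add_zero]
  · rw [if_neg h1, zero_add]
    split_ifs with h2 h3
    · exact le_rfl
    · exact absurd ⟨hsu.trans h2.1, h2.2⟩ h3
    · exact zero_le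
    · exact le_rfl

lemma incr_le_control (κ : ℝ) (ω : PathSpace m α) {s t : ℝ} (n j : ℕ) (hs : s ≤ j / 2 ^ n)
    (ht : (j + 1) / 2 ^ n ≤ t) :
    ENNReal.ofReal (2 ^ (κ * n)) * incr ω (j / 2 ^ n) ((j + 1) / 2 ^ n) ≤
      dyadicControl κ ω s t := by
  have := ENNReal.le_tsum (f := fun I : ℕ × ℕ =>
    if s ≤ (I.2 : ℝ) / 2 ^ I.1 ∧ ((I.2 : ℝ) + 1) / 2 ^ I.1 ≤ t then
    ENNReal.ofReal (2 ^ (κ * I.1)) * incr ω (I.2 / 2 ^ I.1) ((I.2 + 1) / 2 ^ I.1) else 0) (n, j)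
  rwa [if_pos ⟨hs, ht⟩] at this

/-- A single term of the control already bounds the increment: the weight `2 ^ (κ n)`, after taking
the power `α`, gives geometric decay in the level. -/
lemma norm_dyadic_le (hα : 0 < α) (κ : ℝ) (ω : PathSpace m α) {s t : ℝ} (n j : ℕ)
    (hs : s ≤ j / 2 ^ n) (ht : (j + 1) / 2 ^ n ≤ t) (hfin : dyadicControl κ ω s t ≠ ∞) :
    ‖ω.x (j / 2 ^ n) ((j + 1) / 2 ^ n)‖ ≤
        ((2 : ℝ) ^ (-(κ * α))) ^ n * (dyadicControl κ ω s t).toReal ^ α ∧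
      ‖ω.XX (j / 2 ^ n) ((j + 1) / 2 ^ n)‖ ≤
        (((2 : ℝ) ^ (-(κ * α))) ^ n * (dyadicControl κ ω s t).toReal ^ α) ^ 2 := by
  set w := (dyadicControl κ ω s t).toReal with hw
  have hw0 : 0 ≤ w := ENNReal.toReal_nonneg
  have h := incr_le_control κ ω n j hs ht
  have h2pos : (0 : ℝ) < 2 ^ (κ * n) := by positivity
  have key : ∀ (r β : ℝ), 0 ≤ r → 0 < β →
      ENNReal.ofReal (2 ^ (κ * n)) * ENNReal.ofReal (r ^ (1 / β)) ≤ dyadicControl κ ω s t →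
      r ≤ (2 ^ (-(κ * n)) * w) ^ β := by
    intro r β hr hβ hle
    rw [← ENNReal.ofReal_mul h2pos.le, ENNReal.ofReal_le_iff_le_toReal hfin] at hle
    have h1 : r ^ (1 / β) ≤ 2 ^ (-(κ * n)) * w := by
      rw [Real.rpow_neg (by norm_num), ← div_eq_inv_mul, le_div_iff₀ h2pos]
      linarith
    calc r = (r ^ (1 / β)) ^ β := by
          rw [← Real.rpow_mul hr, one_div_mul_cancel hβ.ne', Real.rpow_one]
      _ ≤ _ := Real.rpow_le_rpow (by positivity) h1 hβ.le
  have e : (2 ^ (-(κ * n)) * w) ^ α = ((2 : ℝ) ^ (-(κ * α))) ^ n * w ^ α := by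
    rw [Real.mul_rpow (by positivity) hw0, ← Real.rpow_mul (by norm_num), ← Real.rpow_natCast,
      ← Real.rpow_mul (by norm_num)]
    congr 2
    ring
  constructor
  · rw [← e]
    refine key _ α (norm_nonneg _) hα (le_trans ?_ h)
    gcongr
    exact le_self_add
  · have e2 : ((2 ^ (-(κ * n)) * w) ^ α) ^ 2 = (2 ^ (-(κ * n)) * w) ^ (2 * α) := by
      rw [mul_comm 2 α, Real.rpow_mul (by positivity), Real.rpow_two]
    rw [← e, e2]
    refine key _ _ (norm_nonneg _) (by positivity) (le_trans ?_ h)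
    gcongr
    exact le_add_self

/-- The dyadic control dominates the increments over all intervals. -/
theorem norm_le_control (hα : 0 < α) {κ : ℝ} (hκ : 0 < κ) :
    ∃ C : ℝ, 0 < C ∧ ∀ (ω : PathSpace m α) (s t : ℝ), 0 ≤ s → s ≤ t → t ≤ s + 1 →
      dyadicControl κ ω s t ≠ ∞ →
      ‖ω.x s t‖ ≤ C * ((t - s) ^ κ * (dyadicControl κ ω s t).toReal) ^ α ∧
      ‖ω.XX s t‖ ≤ C * (((t - s) ^ κ * (dyadicControl κ ω s t).toReal) ^ α) ^ 2 := by
  set ρ : ℝ := 2 ^ (-(κ * α)) with hρ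
  have hρ1 : ρ < 1 := Real.rpow_lt_one_of_one_lt_of_neg one_lt_two (by
    have := mul_pos hκ hα; linarith)
  have hρ0 : 0 < ρ := by positivity
  obtain ⟨C, hC, h⟩ := norm_le_of_dyadic (m := m) hα hρ0 hρ1
  refine ⟨C, hC, fun ω s t hs hst ht hfin => ?_⟩
  set w := (dyadicControl κ ω s t).toReal with hw
  have hw0 : 0 ≤ w := ENNReal.toReal_nonneg
  rcases hst.eq_or_lt with rfl | hlt
  · have := Real.rpow_nonneg (sub_nonneg.2 hst) κ
    simp only [PathSpace.x_self, PathSpace.XX_self, norm_zero]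
    constructor <;> positivity
  have hpos : 0 < t - s := sub_pos.2 hlt
  have hex : ∃ n : ℕ, 1 ≤ (t - s) * 2 ^ n := by
    obtain ⟨n, hn⟩ := pow_unbounded_of_one_lt (1 / (t - s)) one_lt_two
    rw [div_lt_iff₀ hpos] at hn
    exact ⟨n, by linarith⟩
  classical
  -- The first level whose mesh is at most `t - s`. Minimality gives the upper bound `2`; at level
  -- zero it comes from `t ≤ s + 1`.
  set n₀ := Nat.find hex with hn₀
  have h1 : 1 ≤ (t - s) * 2 ^ n₀ := Nat.find_spec hex
  have h2 : (t - s) * 2 ^ n₀ < 2 := by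
    rcases Nat.eq_zero_or_pos n₀ with h0 | h0
    · rw [h0]; simp; linarith
    · obtain ⟨k, hk⟩ := Nat.exists_eq_add_of_le' h0
      have := Nat.find_min hex (m := k) (by omega)
      rw [hk, pow_succ]
      linarith
  have hρn : ρ ^ n₀ ≤ ((t - s) ^ κ) ^ α := by
    have : ρ ^ n₀ = (((2 : ℝ) ^ n₀)⁻¹ ^ κ) ^ α := by
      rw [hρ, ← Real.rpow_natCast, ← Real.rpow_mul (by norm_num), ← Real.rpow_natCast,
        ← Real.rpow_neg (by norm_num), ← Real.rpow_mul (by norm_num),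
        ← Real.rpow_mul (by norm_num)]
      congr 1
      ring
    rw [this]
    have : ((2 : ℝ) ^ n₀)⁻¹ ≤ t - s := by
      rw [inv_le_iff_one_le_mul₀ (by positivity)]; exact h1
    gcongr
  have := h ω s t (w ^ α) n₀ hs (by positivity) h1 h2
    (fun n j hj hj' => norm_dyadic_le hα κ ω n j hj hj' hfin)
  have hle : ρ ^ n₀ * w ^ α ≤ ((t - s) ^ κ * w) ^ α := by
    rw [Real.mul_rpow (by positivity) hw0]
    gcongr
  refine ⟨this.1.trans ?_, this.2.trans ?_⟩ <;> gcongr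

/-- Level `n` has at most `2 * 2 ^ n` intervals, each of weight `2 ^ (κ n)` and moment of order `2 ^
(-n ν / α)`. The ratio `2 ^ (κ + 1 - ν / α)` is below one. -/
lemma lintegral_control_lt_top {ν : ℝ} {P : Measure (PathSpace m α)}
    (hP : NoiseHyp ν P) {κ : ℝ} (hκ : κ < 1 / α * ν - 1) :
    ∫⁻ ω, dyadicControl κ ω 0 2 ∂P < ∞ := by
  obtain ⟨C, hC⟩ := hP.moments 2 (by norm_num)
  set β := 1 / α * ν with hβ
  unfold dyadicControl
  rw [lintegral_tsum (fun I => by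
    split_ifs
    · exact ((measurable_incr _ _).const_mul _).aemeasurable
    · exact aemeasurable_const)]
  set r : ℝ := 2 ^ (κ + 1 - β) with hr
  have hr0 : 0 < r := by positivity
  have hr1 : r < 1 := Real.rpow_lt_one_of_one_lt_of_neg one_lt_two (by linarith)
  have hterm : ∀ I : ℕ × ℕ, ∫⁻ ω, (if (0 : ℝ) ≤ (I.2 : ℝ) / 2 ^ I.1 ∧
      ((I.2 : ℝ) + 1) / 2 ^ I.1 ≤ 2 then ENNReal.ofReal (2 ^ (κ * I.1)) *
        incr ω (I.2 / 2 ^ I.1) ((I.2 + 1) / 2 ^ I.1) else 0) ∂P ≤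
      if I.2 < 2 * 2 ^ I.1 then
        ENNReal.ofReal (|C| * (2 ^ (κ * I.1) * ((2 : ℝ) ^ I.1)⁻¹ ^ β)) else 0 := by
    rintro ⟨n, j⟩
    dsimp only
    split_ifs with h1 h2 h2
    · rw [lintegral_const_mul _ (measurable_incr _ _)]
      refine (mul_le_mul_right (hC _ _ h1.1 (by gcongr; linarith) h1.2) _).trans ?_
      rw [← ENNReal.ofReal_mul (by positivity)]
      apply ENNReal.ofReal_le_ofReal
      rw [show ((j : ℝ) + 1) / 2 ^ n - j / 2 ^ n = ((2 : ℝ) ^ n)⁻¹ by ring]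
      have : C * ((2 : ℝ) ^ n)⁻¹ ^ β ≤ |C| * ((2 : ℝ) ^ n)⁻¹ ^ β := by
        gcongr; exact le_abs_self C
      calc _ ≤ 2 ^ (κ * n) * (|C| * ((2 : ℝ) ^ n)⁻¹ ^ β) := by gcongr
        _ = _ := by ring
    · exfalso
      apply h2
      have := h1.2
      rw [div_le_iff₀ (by positivity)] at this
      have h3 : j + 1 ≤ 2 * 2 ^ n := by exact_mod_cast this
      omega
    · simp
    · simp
  refine (ENNReal.tsum_le_tsum hterm).trans_lt ?_
  rw [ENNReal.tsum_prod']
  have hinner : ∀ n : ℕ, ∑' j : ℕ, (if j < 2 * 2 ^ n then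
      ENNReal.ofReal (|C| * (2 ^ (κ * n) * ((2 : ℝ) ^ n)⁻¹ ^ β)) else 0) =
      ENNReal.ofReal (2 * |C|) * ENNReal.ofReal (r ^ n) := by
    intro n
    rw [tsum_eq_sum (s := Finset.range (2 * 2 ^ n)) (fun j hj => by
      rw [if_neg (by simpa using hj)])]
    rw [Finset.sum_congr rfl (fun j hj => if_pos (by simpa using hj)), Finset.sum_const,
      Finset.card_range, nsmul_eq_mul, ← ENNReal.ofReal_natCast,
      ← ENNReal.ofReal_mul (by positivity), ← ENNReal.ofReal_mul (by positivity)]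
    congr 1
    have : r ^ n = 2 ^ n * (2 ^ (κ * n) * ((2 : ℝ) ^ n)⁻¹ ^ β) := by
      rw [hr, ← Real.rpow_natCast, ← Real.rpow_mul (by norm_num), ← Real.rpow_natCast,
        ← Real.rpow_neg (by norm_num), ← Real.rpow_mul (by norm_num),
        ← Real.rpow_add (by norm_num), ← Real.rpow_add (by norm_num)]
      congr 1
      ring
    rw [this]
    push_cast
    ring
  simp only [hinner]
  rw [ENNReal.tsum_mul_left]
  refine ENNReal.mul_lt_top ENNReal.ofReal_lt_top ?_
  rw [← ENNReal.ofReal_tsum_of_nonneg (fun n => by positivity)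
    (summable_geometric_of_lt_one hr0.le hr1)]
  exact ENNReal.ofReal_lt_top

variable {d : ℕ}

/-! ### Products over a dyadic tree -/

/-- The product of the factors `Ξ s, Ξ (s + Δ), …, Ξ (s + (2 ^ n - 1) Δ)`, later factors to the
left. -/
def dyadicProd {R : Type*} [Mul R] (Ξ : ℝ → R) (Δ : ℝ) : ℕ → ℝ → R
  | 0, s => Ξ s
  | n + 1, s => dyadicProd Ξ Δ n (s + 2 ^ n * Δ) * dyadicProd Ξ Δ n s

section Tree

variable {R : Type*} [NormedRing R] {Ξ : ℕ → ℝ → R} {v : ℕ → ℝ → ℝ} {Δ σ T ρ c C η M : ℝ}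

/-- A multiplicative sewing lemma on a dyadic tree. -/
theorem norm_dyadicProd_sub_le (hΔ : 0 < Δ) (hρ1 : ρ ≤ 1) (hM0 : 0 ≤ M) (hη : 0 ≤ η)
    (hv0 : ∀ n s, 0 ≤ v n s)
    (hv : ∀ n s, σ ≤ s → s + 2 ^ (n + 1) * Δ ≤ T →
      v n s + v n (s + 2 ^ n * Δ) ≤ ρ * v (n + 1) s)
    (hR : ∀ n s, σ ≤ s → s + 2 ^ (n + 1) * Δ ≤ T → v (n + 1) s ≤ c →
      ‖Ξ n (s + 2 ^ n * Δ) * Ξ n s - Ξ (n + 1) s‖ ≤ C * v (n + 1) s)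
    (hΞ : ∀ n s, σ ≤ s → s + 2 ^ n * Δ ≤ T → v n s ≤ c → ‖Ξ n s‖ ≤ 1 + η)
    (hM : C + ρ * M * (1 + η + M * c) ≤ M) (n : ℕ) :
    ∀ s, σ ≤ s → s + 2 ^ n * Δ ≤ T → v n s ≤ c →
      ‖dyadicProd (Ξ 0) Δ n s - Ξ n s‖ ≤ M * v n s := by
  induction n with
  | zero =>
    intro s _ _ _
    simpa [dyadicProd] using mul_nonneg hM0 (hv0 0 s)
  | succ n ih =>
    intro s hs hsT hvc
    have hp : 0 < 2 ^ n * Δ := by positivity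
    have hpow : (2 : ℝ) ^ (n + 1) * Δ = 2 ^ n * Δ + 2 ^ n * Δ := by rw [pow_succ]; ring
    have hsum := hv n s hs hsT
    set v1 := v n s with hv1
    set v2 := v n (s + 2 ^ n * Δ) with hv2
    set V := v (n + 1) s with hV
    have h1 : 0 ≤ v1 := hv0 _ _
    have h2 : 0 ≤ v2 := hv0 _ _
    have hV0 : 0 ≤ V := hv0 _ _
    have hρV : ρ * V ≤ V := mul_le_of_le_one_left hV0 hρ1
    have hD1 := ih s hs (by linarith) (by linarith)
    have hD2 := ih (s + 2 ^ n * Δ) (by linarith) (by linarith) (by linarith)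
    have hΞ1 := hΞ n s hs (by linarith) (by linarith)
    have hΞ2 := hΞ n (s + 2 ^ n * Δ) (by linarith) (by linarith) (by linarith)
    have hRn := hR n s hs hsT hvc
    set J1 := dyadicProd (Ξ 0) Δ n s
    set J2 := dyadicProd (Ξ 0) Δ n (s + 2 ^ n * Δ)
    set X1 := Ξ n s
    set X2 := Ξ n (s + 2 ^ n * Δ)
    have hc0 : 0 ≤ c := hV0.trans hvc
    -- The local error plus the errors inherited from the two halves; the quadratic term is tamed by
    -- `v ≤ c`.
    have e : dyadicProd (Ξ 0) Δ (n + 1) s - Ξ (n + 1) s =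
        (X2 * X1 - Ξ (n + 1) s) + ((J2 - X2) * X1 + X2 * (J1 - X1) + (J2 - X2) * (J1 - X1)) := by
      change J2 * J1 - _ = _
      noncomm_ring
    rw [e]
    calc _ ≤ ‖X2 * X1 - Ξ (n + 1) s‖ + (‖(J2 - X2) * X1‖ + ‖X2 * (J1 - X1)‖ +
          ‖(J2 - X2) * (J1 - X1)‖) := (norm_add_le _ _).trans (add_le_add le_rfl norm_add₃_le)
      _ ≤ C * V + (M * v2 * (1 + η) + (1 + η) * (M * v1) + M * c * (M * v1)) := by
        refine add_le_add hRn (add_le_add (add_le_add ?_ ?_) ?_)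
        · exact (norm_mul_le _ _).trans (by gcongr)
        · exact (norm_mul_le _ _).trans (by gcongr)
        · refine (norm_mul_le _ _).trans (mul_le_mul (hD2.trans ?_) hD1 (norm_nonneg _)
            (by positivity))
          gcongr
          linarith
      _ ≤ C * V + M * (1 + η + M * c) * (v1 + v2) := by
        have : 0 ≤ M * (M * c) * v2 := by positivity
        nlinarith
      _ ≤ C * V + M * (1 + η + M * c) * (ρ * V) := by gcongr
      _ = (C + ρ * M * (1 + η + M * c)) * V := by ring
      _ ≤ M * V := by gcongr

/-- The exponential growth bound for products over a dyadic tree. -/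
theorem norm_dyadicProd_le_exp (hΔ : 0 < Δ) (hv0 : ∀ n s, 0 ≤ v n s) {K : ℝ} (hK : 0 ≤ K)
    (hv : ∀ n s, σ ≤ s → s + 2 ^ (n + 1) * Δ ≤ T →
      v n s + v n (s + 2 ^ n * Δ) ≤ ρ * v (n + 1) s)
    (hsmall : ∀ n s, σ ≤ s → s + 2 ^ n * Δ ≤ T → v n s ≤ c → ‖dyadicProd (Ξ 0) Δ n s‖ ≤ 2)
    (hleaf : ∀ s, σ ≤ s → s + Δ ≤ T → c < v 0 s → ‖Ξ 0 s‖ ≤ Real.exp (K * v 0 s))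
    (hρ1 : ρ ≤ 1) (hKc : Real.log 2 ≤ K * (1 - ρ) * c) (n : ℕ) :
    ∀ s, σ ≤ s → s + 2 ^ n * Δ ≤ T →
      ‖dyadicProd (Ξ 0) Δ n s‖ ≤ 2 * Real.exp (K * v n s) := by
  have htriv : ∀ n s, σ ≤ s → s + 2 ^ n * Δ ≤ T → v n s ≤ c →
      ‖dyadicProd (Ξ 0) Δ n s‖ ≤ 2 * Real.exp (K * v n s) := fun n s hs hsT hc => by
    have := Real.one_le_exp (mul_nonneg hK (hv0 n s))
    linarith [hsmall n s hs hsT hc]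
  induction n with
  | zero =>
    intro s hs hsT
    rcases le_or_gt (v 0 s) c with hc | hc
    · exact htriv 0 s hs hsT hc
    · have := hleaf s hs (by simpa using hsT) hc
      change ‖Ξ 0 s‖ ≤ _
      linarith [Real.exp_pos (K * v 0 s)]
  | succ n ih =>
    intro s hs hsT
    rcases le_or_gt (v (n + 1) s) c with hc | hc
    · exact htriv _ s hs hsT hc
    have hp : 0 < 2 ^ n * Δ := by positivity
    have hpow : (2 : ℝ) ^ (n + 1) * Δ = 2 ^ n * Δ + 2 ^ n * Δ := by rw [pow_succ]; ring
    have h1 := ih s hs (by linarith)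
    have h2 := ih (s + 2 ^ n * Δ) (by linarith) (by linarith)
    have hsum := hv n s hs hsT
    -- Splitting costs a factor two, and the strict loss of the control pays for it: `K (1 - ρ) v ≥
    -- K (1 - ρ) c ≥ log 2`.
    calc _ ≤ ‖dyadicProd (Ξ 0) Δ n (s + 2 ^ n * Δ)‖ * ‖dyadicProd (Ξ 0) Δ n s‖ :=
          norm_mul_le _ _
      _ ≤ (2 * Real.exp (K * v n (s + 2 ^ n * Δ))) * (2 * Real.exp (K * v n s)) := by gcongr
      _ = 2 * Real.exp (Real.log 2 + K * (v n s + v n (s + 2 ^ n * Δ))) := by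
        rw [Real.exp_add, Real.exp_log two_pos, mul_add, Real.exp_add]; ring
      _ ≤ 2 * Real.exp (K * v (n + 1) s) := by
        gcongr
        have a1 : K * (v n s + v n (s + 2 ^ n * Δ)) ≤ K * (ρ * v (n + 1) s) := by gcongr
        have a2 : K * (1 - ρ) * c ≤ K * (1 - ρ) * v (n + 1) s := by
          have : 0 ≤ 1 - ρ := by linarith
          gcongr
        nlinarith

/-- The local error of the second-order expansion of a product of two rough increments. -/
lemma norm_mul_sub_le {S x₁ x₂ X₁ X₂ : R} {σ a b : ℝ} (hσ : ‖S - 1‖ ≤ σ) (hx₁ : ‖x₁‖ ≤ a)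
    (hx₂ : ‖x₂‖ ≤ a) (hX₁ : ‖X₁‖ ≤ b) (hX₂ : ‖X₂‖ ≤ b) :
    ‖(S + (x₂ + X₂)) * (S + (x₁ + X₁)) - (S * S + (x₁ + x₂ + (X₁ + X₂ + x₂ * x₁)))‖ ≤
      2 * (σ * (a + b)) + (2 * (a * b) + b * b) := by
  have e : (S + (x₂ + X₂)) * (S + (x₁ + X₁)) - (S * S + (x₁ + x₂ + (X₁ + X₂ + x₂ * x₁))) =
      ((S - 1) * (x₁ + X₁) + (x₂ + X₂) * (S - 1)) + (x₂ * X₁ + X₂ * x₁ + X₂ * X₁) := by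
    noncomm_ring
  have ha : 0 ≤ a := (norm_nonneg _).trans hx₁
  have hb : 0 ≤ b := (norm_nonneg _).trans hX₁
  have hσ0 : 0 ≤ σ := (norm_nonneg _).trans hσ
  have h1 : ‖x₁ + X₁‖ ≤ a + b := (norm_add_le _ _).trans (add_le_add hx₁ hX₁)
  have h2 : ‖x₂ + X₂‖ ≤ a + b := (norm_add_le _ _).trans (add_le_add hx₂ hX₂)
  have hmul : ∀ {y z : R} {p q : ℝ}, ‖y‖ ≤ p → ‖z‖ ≤ q → ‖y * z‖ ≤ p * q := fun hy hz =>
    (norm_mul_le _ _).trans (mul_le_mul hy hz (norm_nonneg _) ((norm_nonneg _).trans hy))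
  rw [e]
  calc _ ≤ (σ * (a + b) + (a + b) * σ) + (a * b + b * a + b * b) :=
        (norm_add_le _ _).trans (add_le_add ((norm_add_le _ _).trans
          (add_le_add (hmul hσ h1) (hmul h2 hσ)))
          (norm_add₃_le.trans (add_le_add (add_le_add (hmul hx₂ hX₁) (hmul hX₂ hx₁))
            (hmul hX₂ hX₁))))
    _ = _ := by ring

end Tree

/-! ### The linearized scheme -/

/-- The operator `y ↦ G y u`. -/
noncomputable def level1 (G : Vec d →L[ℝ] Vec m →L[ℝ] Vec d) (u : Vec m) : Vec d →L[ℝ] Vec d :=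
  G.flip u

/-- The operator `y ↦ ∑ᵢⱼ X^{ij} G (G y eᵢ) eⱼ`. -/
noncomputable def level2 (G : Vec d →L[ℝ] Vec m →L[ℝ] Vec d) (X : Ten m) : Vec d →L[ℝ] Vec d :=
  ∑ i : Fin m, ∑ j : Fin m, X (i, j) •
    (level1 G (EuclideanSpace.single j 1) * level1 G (EuclideanSpace.single i 1))

section Linearization

variable (G : Vec d →L[ℝ] Vec m →L[ℝ] Vec d)

lemma level1_add (u v : Vec m) : level1 G (u + v) = level1 G u + level1 G v := by
  simp [level1]

lemma norm_level1_le (u : Vec m) : ‖level1 G u‖ ≤ ‖G‖ * ‖u‖ := by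
  have := G.flip.le_opNorm u
  rwa [ContinuousLinearMap.opNorm_flip] at this

lemma level2_add (X Y : Ten m) : level2 G (X + Y) = level2 G X + level2 G Y := by
  simp only [level2, ← Finset.sum_add_distrib]
  exact Finset.sum_congr rfl fun i _ => Finset.sum_congr rfl fun j _ =>
    add_smul (R := ℝ) (M := Vec d →L[ℝ] Vec d) (X (i, j)) (Y (i, j)) _

/-- The algebraic counterpart of Chen's relation: the tensor correction becomes the composition of
first levels, with the later increment acting on the left. -/
lemma level2_tensor (u v : Vec m) : level2 G (tensor u v) = level1 G v * level1 G u := by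
  have h : ∀ w : Vec m, level1 G w = ∑ i : Fin m, w i • level1 G (EuclideanSpace.single i 1) := by
    intro w
    have hw : w = ∑ i : Fin m, w i • EuclideanSpace.single i (1 : ℝ) := by
      ext j
      simp [Pi.single_apply]
    conv_lhs => rw [hw]
    simp [level1, map_sum]
  rw [h u, h v, Finset.sum_mul_sum, Finset.sum_comm]
  unfold level2
  refine Finset.sum_congr rfl fun i _ => Finset.sum_congr rfl fun j _ => ?_
  rw [tensor_apply, mul_comm]
  refine ContinuousLinearMap.ext fun y => ?_
  simp [smul_smul, mul_comm]

lemma norm_level2_le (X : Ten m) : ‖level2 G X‖ ≤ (m : ℝ) ^ 2 * (‖G‖ ^ 2 * ‖X‖) := by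
  unfold level2
  have h1 : ∀ i : Fin m, ‖level1 G (EuclideanSpace.single i 1)‖ ≤ ‖G‖ := fun i => by
    simpa using norm_level1_le G (EuclideanSpace.single i 1)
  have : ∀ i j : Fin m, ‖X (i, j) • (level1 G (EuclideanSpace.single j 1) *
      level1 G (EuclideanSpace.single i 1))‖ ≤ ‖G‖ ^ 2 * ‖X‖ := by
    intro i j
    rw [norm_smul, mul_comm]
    refine mul_le_mul ?_ (PiLp.norm_apply_le X (i, j)) (norm_nonneg _) (by positivity)
    rw [sq]
    exact (norm_mul_le _ _).trans (mul_le_mul (h1 j) (h1 i) (norm_nonneg _) (norm_nonneg G))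
  calc _ ≤ ∑ i : Fin m, ∑ j : Fin m, ‖G‖ ^ 2 * ‖X‖ :=
        (norm_sum_le _ _).trans (Finset.sum_le_sum fun i _ =>
          (norm_sum_le _ _).trans (Finset.sum_le_sum fun j _ => this i j))
    _ = _ := by simp; ring

/-- The first two levels of the linearized noise over `[s, t]`. -/
noncomputable def linNoise (ω : PathSpace m α) (s t : ℝ) : Vec d →L[ℝ] Vec d :=
  level1 G (ω.x s t) + level2 G (ω.XX s t)

lemma linNoise_eq (ω : PathSpace m α) (s u t : ℝ) :
    linNoise G ω s t = level1 G (ω.x s u) + level1 G (ω.x u t) +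
      (level2 G (ω.XX s u) + level2 G (ω.XX u t) + level1 G (ω.x u t) * level1 G (ω.x s u)) := by
  unfold linNoise
  rw [ω.XX_add s u t, ω.x_add s u t, level1_add, level2_add, level2_add, level2_tensor]

/-- The one-step operator of the linearized scheme. -/
noncomputable def linStep (A : Vec d →L[ℝ] Vec d) (ω : PathSpace m α) (Δ s : ℝ) :
    Vec d →L[ℝ] Vec d :=
  (1 + Δ • A) + linNoise G ω s (s + Δ)

end Linearization

lemma rpow_le_one_add {x β : ℝ} (hx : 0 ≤ x) (hβ0 : 0 ≤ β) (hβ1 : β ≤ 1) : x ^ β ≤ 1 + x := by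
  rcases le_total x 1 with h | h
  · linarith [Real.rpow_le_one hx h hβ0]
  · have := Real.rpow_le_rpow_of_exponent_le h hβ1
    rw [Real.rpow_one] at this
    linarith

lemma exists_small_rpow_add (hα : 0 < α) (B M : ℝ) {ε : ℝ} (hε : 0 < ε) :
    ∃ c : ℝ, 0 < c ∧ c ≤ 1 ∧ B * c ^ α + M * c ≤ ε := by
  have hcont : ContinuousAt (fun c : ℝ => B * c ^ α + M * c) 0 :=
    (continuousAt_const.mul (continuousAt_id.rpow_const (Or.inr hα.le))).add (by fun_prop)
  have h0 : (fun c : ℝ => B * c ^ α + M * c) 0 < ε := by simpa [hα.ne'] using hε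
  have h1 : ∀ᶠ c : ℝ in nhdsWithin 0 (Ioi 0), B * c ^ α + M * c < ε :=
    (hcont.eventually (gt_mem_nhds h0)).filter_mono nhdsWithin_le_nhds
  have h2 : ∀ᶠ c : ℝ in nhdsWithin 0 (Ioi 0), c ∈ Ioc (0 : ℝ) 1 := Ioc_mem_nhdsGT one_pos
  obtain ⟨c, hc1, hc2⟩ := (h1.and h2).exists
  exact ⟨c, hc2.1, hc2.2, hc1.le⟩

lemma norm_pow_two_pow_sub_one_le {R : Type*} [NormedRing R] {S : R} {b : ℝ} (hS : ‖S‖ ≤ 1)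
    (hb : ‖S - 1‖ ≤ b) (n : ℕ) : ‖S ^ 2 ^ n - 1‖ ≤ 2 ^ n * b := by
  induction n with
  | zero => simpa using hb
  | succ n ih =>
    have h1 : ‖S ^ 2 ^ n‖ ≤ 1 :=
      (norm_pow_le' S (by positivity)).trans (pow_le_one₀ (norm_nonneg _) hS)
    have e : S ^ 2 ^ (n + 1) - 1 = (S ^ 2 ^ n - 1) * S ^ 2 ^ n + (S ^ 2 ^ n - 1) := by
      rw [pow_succ 2 n, mul_two, pow_add]
      noncomm_ring
    rw [e]
    calc _ ≤ ‖S ^ 2 ^ n - 1‖ * ‖S ^ 2 ^ n‖ + ‖S ^ 2 ^ n - 1‖ :=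
          (norm_add_le _ _).trans (add_le_add (norm_mul_le _ _) le_rfl)
      _ ≤ 2 ^ n * b * 1 + 2 ^ n * b := by
        have := (norm_nonneg _).trans ih
        gcongr
      _ = _ := by rw [pow_succ]; ring

/-- The control used for the linearized scheme with small noise intensity. -/
noncomputable def scaledControl (κ δ : ℝ) (ω : PathSpace m α) (s l : ℝ) : ℝ :=
  δ * (l ^ κ * ((dyadicControl κ ω s (s + l)).toReal + l))

lemma scaledControl_nonneg {κ δ : ℝ} (hδ : 0 ≤ δ) (ω : PathSpace m α) (s : ℝ) {l : ℝ}
    (hl : 0 ≤ l) : 0 ≤ scaledControl κ δ ω s l := by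
  have : 0 ≤ (dyadicControl κ ω s (s + l)).toReal := ENNReal.toReal_nonneg
  unfold scaledControl
  positivity

lemma control_ne_top {κ : ℝ} {ω : PathSpace m α} (hfin : dyadicControl κ ω 0 2 ≠ ∞) {s t : ℝ}
    (hs : 0 ≤ s) (ht : t ≤ 2) : dyadicControl κ ω s t ≠ ∞ :=
  ne_top_of_le_ne_top hfin (control_mono κ ω hs ht)

/-- The additive part is superadditive and `l ^ κ` shrinks by `2 ^ (-κ)` under halving. This gain
plays the role of an exponent larger than one in the usual sewing lemma. -/
lemma scaledControl_add_le {κ δ : ℝ} (hδ : 0 ≤ δ) {ω : PathSpace m α}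
    (hfin : dyadicControl κ ω 0 2 ≠ ∞) {s l : ℝ} (hs : 0 ≤ s) (hl : 0 < l) (hl2 : s + 2 * l ≤ 2) :
    scaledControl κ δ ω s l + scaledControl κ δ ω (s + l) l ≤
      2 ^ (-κ) * scaledControl κ δ ω s (2 * l) := by
  have h1 := control_add_le κ ω (show s ≤ s + l by linarith) (show s + l ≤ s + 2 * l by linarith)
  have h2 := ENNReal.toReal_mono (control_ne_top hfin hs hl2) h1
  rw [ENNReal.toReal_add (control_ne_top hfin hs (by linarith))
    (control_ne_top hfin (by linarith) (by linarith))] at h2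
  unfold scaledControl
  rw [Real.mul_rpow (by norm_num) hl.le, show s + l + l = s + 2 * l by ring]
  have h3 : (2 : ℝ) ^ (-κ) * 2 ^ κ = 1 := by rw [← Real.rpow_add two_pos]; simp
  have h4 : 0 ≤ δ * l ^ κ := by positivity
  calc _ = δ * l ^ κ * ((dyadicControl κ ω s (s + l)).toReal +
        (dyadicControl κ ω (s + l) (s + 2 * l)).toReal + 2 * l) := by ring
    _ ≤ δ * l ^ κ * ((dyadicControl κ ω s (s + 2 * l)).toReal + 2 * l) := by gcongr
    _ = (2 ^ (-κ) * 2 ^ κ) * (δ * l ^ κ * ((dyadicControl κ ω s (s + 2 * l)).toReal + 2 * l)) := by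
      rw [h3, one_mul]
    _ = _ := by ring

/-- The summand `l` in `scaledControl` is there for this: the control is at least `δ l ^ (1 + κ)`,
hence at least `(δ l) ^ (3/2)`. The drift-noise cross terms are estimated this way. -/
lemma mul_le_scaledControl_rpow {κ δ : ℝ} (hκ1 : κ ≤ 1 / 2) (hδ : 0 < δ) (hδ1 : δ ≤ 1)
    (ω : PathSpace m α) (s : ℝ) {l : ℝ} (hl : 0 < l) (hl1 : l ≤ 1) :
    δ * l ≤ scaledControl κ δ ω s l ^ (2 / 3 : ℝ) := by
  have hw : 0 ≤ (dyadicControl κ ω s (s + l)).toReal := ENNReal.toReal_nonneg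
  have h1 : (δ * l) ^ (3 / 2 : ℝ) ≤ scaledControl κ δ ω s l := by
    rw [Real.mul_rpow hδ.le hl.le]
    have a1 : δ ^ (3 / 2 : ℝ) ≤ δ := by
      simpa using Real.rpow_le_rpow_of_exponent_ge hδ hδ1 (show (1 : ℝ) ≤ 3 / 2 by norm_num)
    have a2 : l ^ (3 / 2 : ℝ) ≤ l ^ κ * l := by
      have := Real.rpow_le_rpow_of_exponent_ge hl hl1 (show κ + 1 ≤ 3 / 2 by linarith)
      rwa [Real.rpow_add hl, Real.rpow_one] at this
    unfold scaledControl
    refine mul_le_mul a1 (a2.trans ?_) (by positivity) hδ.le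
    gcongr
    linarith
  calc δ * l = ((δ * l) ^ (3 / 2 : ℝ)) ^ (2 / 3 : ℝ) := by
        rw [← Real.rpow_mul (by positivity)]; norm_num
    _ ≤ _ := by gcongr

/-- Of the two powers of `δ` in `‖G‖ ≤ δ ^ 2`, one is absorbed into the control through `δ ≤ δ ^ α`;
the other stays outside, to be paired with the drift. -/
lemma norm_level_le (hα : 0 < α) (hα1 : α ≤ 1) {κ : ℝ} (hκ : 0 < κ) :
    ∃ B : ℝ, 0 < B ∧ ∀ (G : Vec d →L[ℝ] Vec m →L[ℝ] Vec d) (δ : ℝ) (ω : PathSpace m α) (s l : ℝ),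
      0 < δ → δ ≤ 1 → ‖G‖ ≤ δ ^ 2 → 0 ≤ s → 0 ≤ l → l ≤ 1 → dyadicControl κ ω s (s + l) ≠ ∞ →
      ‖level1 G (ω.x s (s + l))‖ ≤ δ * (B * scaledControl κ δ ω s l ^ α) ∧
      ‖level2 G (ω.XX s (s + l))‖ ≤ δ * (B * (scaledControl κ δ ω s l ^ α) ^ 2) := by
  obtain ⟨C, hC, h⟩ := norm_le_control (m := m) hα hκ
  refine ⟨C * (1 + m ^ 2), by positivity, fun G δ ω s l hδ hδ1 hG hs hl hl1 hfin => ?_⟩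
  obtain ⟨h1, h2⟩ := h ω s (s + l) hs (by linarith) (by linarith) hfin
  rw [add_sub_cancel_left] at h1 h2
  have hw : 0 ≤ (dyadicControl κ ω s (s + l)).toReal := ENNReal.toReal_nonneg
  set u := l ^ κ * ((dyadicControl κ ω s (s + l)).toReal + l) with hu
  have hu0 : 0 ≤ u := by positivity
  have hle : (l ^ κ * (dyadicControl κ ω s (s + l)).toReal) ^ α ≤ u ^ α := by
    rw [hu]; gcongr; linarith
  have he : scaledControl κ δ ω s l ^ α = δ ^ α * u ^ α := Real.mul_rpow hδ.le hu0
  have hδα : δ ≤ δ ^ α := by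
    simpa using Real.rpow_le_rpow_of_exponent_ge hδ hδ1 hα1
  set e := scaledControl κ δ ω s l ^ α with hedef
  have hδu : δ * u ^ α ≤ e := by rw [he]; gcongr
  have he0 : 0 ≤ e := by rw [he]; positivity
  have hm : (0 : ℝ) ≤ m ^ 2 := by positivity
  constructor
  · calc _ ≤ ‖G‖ * ‖ω.x s (s + l)‖ := norm_level1_le G _
      _ ≤ δ ^ 2 * (C * u ^ α) := by
        refine mul_le_mul hG (h1.trans ?_) (norm_nonneg _) (by positivity)
        gcongr
      _ = δ * (C * (δ * u ^ α)) := by ring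
      _ ≤ δ * (C * e) := by gcongr
      _ ≤ δ * (C * (1 + m ^ 2) * e) := by
        gcongr
        exact le_mul_of_one_le_right hC.le (by linarith)
  · calc _ ≤ (m : ℝ) ^ 2 * (‖G‖ ^ 2 * ‖ω.XX s (s + l)‖) := norm_level2_le G _
      _ ≤ (m : ℝ) ^ 2 * ((δ ^ 2) ^ 2 * (C * (u ^ α) ^ 2)) := by
        refine mul_le_mul_of_nonneg_left (mul_le_mul ?_ (h2.trans ?_) (norm_nonneg _)
          (by positivity)) hm
        · gcongr
        · gcongr
      _ = δ ^ 2 * (C * m ^ 2 * (δ * u ^ α) ^ 2) := by ring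
      _ ≤ δ * (C * (1 + m ^ 2) * e ^ 2) := by
        refine mul_le_mul ?_ ?_ (by positivity) hδ.le
        · rw [sq]; exact mul_le_of_le_one_left hδ.le hδ1
        · gcongr
          linarith

section Block

variable {G : Vec d →L[ℝ] Vec m →L[ℝ] Vec d} {A : Vec d →L[ℝ] Vec d} {ω : PathSpace m α}
  {κ δ Δ B L : ℝ}

/-- The second-order expansion of the linearized scheme over `2 ^ n` steps. -/
noncomputable def linApprox (G : Vec d →L[ℝ] Vec m →L[ℝ] Vec d) (A : Vec d →L[ℝ] Vec d)
    (ω : PathSpace m α) (Δ : ℝ) (n : ℕ) (s : ℝ) : Vec d →L[ℝ] Vec d :=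
  (1 + Δ • A) ^ 2 ^ n + linNoise G ω s (s + 2 ^ n * Δ)

lemma linApprox_zero : linApprox G A ω Δ 0 = linStep G A ω Δ := by
  funext s
  simp [linApprox, linStep]

lemma norm_linNoise_le {e s t : ℝ} (hδ1 : δ ≤ 1) (hB : 0 < B) (he : 0 ≤ e)
    (h1 : ‖level1 G (ω.x s t)‖ ≤ δ * (B * e)) (h2 : ‖level2 G (ω.XX s t)‖ ≤ δ * (B * e ^ 2)) :
    ‖linNoise G ω s t‖ ≤ B * e + B * e ^ 2 :=
  (norm_add_le _ _).trans (add_le_add (h1.trans (mul_le_of_le_one_left (by positivity) hδ1))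
    (h2.trans (mul_le_of_le_one_left (by positivity) hδ1)))

/-- Chen's relation cancels everything up to second order in the noise. The drift-noise terms left
are of size `V ^ (2/3) V ^ α`, the pure noise terms of size `V ^ (3α)`, and both are at most `V`
since `V ≤ 1` and `α > 1/3`. -/
lemma norm_linApprox_mul_sub_le (hα : 1 / 3 < α) (hκ1 : κ ≤ 1 / 2) (hB : 0 < B)
    (hlev : ∀ s l : ℝ, 0 ≤ s → 0 ≤ l → l ≤ 1 → s + l ≤ 2 →
      ‖level1 G (ω.x s (s + l))‖ ≤ δ * (B * scaledControl κ δ ω s l ^ α) ∧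
      ‖level2 G (ω.XX s (s + l))‖ ≤ δ * (B * (scaledControl κ δ ω s l ^ α) ^ 2))
    (hδ : 0 < δ) (hδ1 : δ ≤ 1) (hfin : dyadicControl κ ω 0 2 ≠ ∞) (hL : 0 ≤ L) (hA : ‖A‖ ≤ L)
    (hΔ : 0 < Δ) (hS : ‖1 + Δ • A‖ ≤ 1) (hκ0 : 0 < κ) (n : ℕ) (s : ℝ) (hs : 0 ≤ s)
    (hs1 : 2 ^ (n + 1) * Δ ≤ 1) (hs2 : s + 2 ^ (n + 1) * Δ ≤ 2)
    (hV : scaledControl κ δ ω s (2 ^ (n + 1) * Δ) ≤ 1) :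
    ‖linApprox G A ω Δ n (s + 2 ^ n * Δ) * linApprox G A ω Δ n s - linApprox G A ω Δ (n + 1) s‖ ≤
      (4 * L * B + 3 * B ^ 2) * scaledControl κ δ ω s (2 ^ (n + 1) * Δ) := by
  have hpow : (2 : ℝ) ^ (n + 1) * Δ = 2 * (2 ^ n * Δ) := by rw [pow_succ]; ring
  rw [hpow] at hs1 hs2 hV ⊢
  set l := 2 ^ n * Δ with hl
  have hl0 : 0 < l := by positivity
  set V := scaledControl κ δ ω s (2 * l) with hVdef
  have hV0 : 0 ≤ V := scaledControl_nonneg hδ.le ω s (by linarith)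
  have hadd := scaledControl_add_le hδ.le hfin hs hl0 hs2
  have h2κ : (2 : ℝ) ^ (-κ) ≤ 1 := Real.rpow_le_one_of_one_le_of_nonpos (by norm_num) (by linarith)
  have hadd' := hadd.trans (mul_le_of_le_one_left hV0 h2κ)
  have hV1 : 0 ≤ scaledControl κ δ ω s l := scaledControl_nonneg hδ.le ω s hl0.le
  have hV2 : 0 ≤ scaledControl κ δ ω (s + l) l := scaledControl_nonneg hδ.le ω _ hl0.le
  set e := V ^ α with he
  have he0 : 0 ≤ e := by positivity
  have he1 : e ≤ 1 := Real.rpow_le_one hV0 hV (by linarith)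
  have hle1 : scaledControl κ δ ω s l ^ α ≤ e :=
    Real.rpow_le_rpow hV1 (by linarith) (by linarith)
  have hle2 : scaledControl κ δ ω (s + l) l ^ α ≤ e :=
    Real.rpow_le_rpow hV2 (by linarith) (by linarith)
  obtain ⟨x1, X1⟩ := hlev s l hs hl0.le (by linarith) (by linarith)
  obtain ⟨x2, X2⟩ := hlev (s + l) l (by linarith) hl0.le (by linarith) (by linarith)
  replace x1 := x1.trans (show _ ≤ δ * (B * e) by gcongr)
  replace x2 := x2.trans (show _ ≤ δ * (B * e) by gcongr)
  replace X1 := X1.trans (show _ ≤ δ * (B * e ^ 2) by gcongr)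
  replace X2 := X2.trans (show _ ≤ δ * (B * e ^ 2) by gcongr)
  have hσ : ‖(1 + Δ • A) ^ 2 ^ n - 1‖ ≤ 2 ^ n * (Δ * L) := by
    refine norm_pow_two_pow_sub_one_le hS ?_ n
    rw [add_sub_cancel_left, norm_smul, Real.norm_of_nonneg hΔ.le]
    gcongr
  have hmain := norm_mul_sub_le hσ x1 x2 X1 X2
  have e1 : linApprox G A ω Δ (n + 1) s = (1 + Δ • A) ^ 2 ^ n * (1 + Δ • A) ^ 2 ^ n +
      (level1 G (ω.x s (s + l)) + level1 G (ω.x (s + l) (s + l + l)) +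
      (level2 G (ω.XX s (s + l)) + level2 G (ω.XX (s + l) (s + l + l)) +
        level1 G (ω.x (s + l) (s + l + l)) * level1 G (ω.x s (s + l)))) := by
    rw [← linNoise_eq, linApprox, ← pow_add, ← mul_two, ← pow_succ]
    congr 2
    rw [hpow]; ring
  rw [e1]
  refine hmain.trans ?_
  have hδl : δ * l ≤ V ^ (2 / 3 : ℝ) := by
    refine (mul_le_scaledControl_rpow hκ1 hδ hδ1 ω s hl0 (by linarith)).trans ?_
    exact Real.rpow_le_rpow hV1 (by linarith) (by norm_num)
  have hVV : V ^ (2 / 3 : ℝ) * e ≤ V := by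
    rcases hV0.eq_or_lt with h | h
    · rw [← h]; simp
    · rw [he, ← Real.rpow_add h]
      simpa using Real.rpow_le_rpow_of_exponent_ge h hV (show (1 : ℝ) ≤ 2 / 3 + α by linarith)
  have he3 : e ^ 3 ≤ V := by
    rcases hV0.eq_or_lt with h | h
    · rw [he, ← h, Real.zero_rpow (by linarith)]; norm_num
    · rw [he, ← Real.rpow_natCast, ← Real.rpow_mul hV0]
      simpa using Real.rpow_le_rpow_of_exponent_ge h hV
        (show (1 : ℝ) ≤ α * (3 : ℕ) by push_cast; linarith)
  have he2 : e ^ 2 ≤ e := by rw [sq]; exact mul_le_of_le_one_left he0 he1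
  have hδ2 : δ ^ 2 ≤ 1 := pow_le_one₀ hδ.le hδ1
  calc 2 * (2 ^ n * (Δ * L) * (δ * (B * e) + δ * (B * e ^ 2))) +
        (2 * (δ * (B * e) * (δ * (B * e ^ 2))) + δ * (B * e ^ 2) * (δ * (B * e ^ 2)))
      = 2 * L * B * ((δ * l) * (e + e ^ 2)) + δ ^ 2 * (B ^ 2 * (e ^ 3 * (2 + e))) := by
        rw [hl]; ring
    _ ≤ 2 * L * B * (V ^ (2 / 3 : ℝ) * (e + e)) + 1 * (B ^ 2 * (V * (2 + 1))) := by gcongr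
    _ = 4 * L * B * (V ^ (2 / 3 : ℝ) * e) + 3 * B ^ 2 * V := by ring
    _ ≤ 4 * L * B * V + 3 * B ^ 2 * V := by gcongr
    _ = _ := by ring

end Block

/-- With `x` at most half the gap `1 - ρ`, the inherited error is at most `M - M (1 - ρ) / 2 = M -
C`, leaving exactly room for the local error `C`. -/
lemma sewing_const_le {ρ C M x : ℝ} (hρ0 : 0 ≤ ρ) (hρ1 : ρ ≤ 1) (hM : 0 ≤ M)
    (hMC : M * (1 - ρ) = 2 * C) (hx : x ≤ (1 - ρ) / 2) : C + ρ * M * (1 + x) ≤ M := by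
  have h1 : ρ * M * (1 + x) ≤ ρ * M * (1 + (1 - ρ) / 2) := by gcongr
  have h2 : ρ * (1 + (1 - ρ) / 2) ≤ 1 - (1 - ρ) / 2 := by nlinarith
  have h3 : M * (ρ * (1 + (1 - ρ) / 2)) ≤ M * (1 - (1 - ρ) / 2) := by gcongr
  linarith

set_option maxHeartbeats 800000 in
/-- The growth of the linearized scheme over a block of time length at most one. -/
theorem linear_block_bound (hα : 1 / 3 < α) (hα2 : α ≤ 1 / 2) {κ L a η : ℝ} (hκ0 : 0 < κ)
    (hκ1 : κ ≤ 1 / 2) (hL : 0 ≤ L) (ha : 0 ≤ a) (hη : 0 < η) :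
    ∃ K : ℝ, 0 < K ∧ ∀ (A : Vec d →L[ℝ] Vec d) (G : Vec d →L[ℝ] Vec m →L[ℝ] Vec d) (δ Δ : ℝ)
      (k : ℕ) (ω : PathSpace m α) (s : ℝ), ‖A‖ ≤ L → 0 < δ → δ ≤ 1 → ‖G‖ ≤ δ ^ 2 → 0 < Δ →
      2 ^ k * Δ ≤ 1 → ‖1 + Δ • A‖ ≤ 1 → ‖(1 + Δ • A) ^ 2 ^ k‖ ≤ Real.exp (-a) → 0 ≤ s →
      s + 2 ^ k * Δ ≤ 2 → dyadicControl κ ω 0 2 ≠ ∞ →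
      ‖dyadicProd (linStep G A ω Δ) Δ k s‖ ≤
        Real.exp (-a + η + K * (δ * (1 + (dyadicControl κ ω 0 2).toReal))) := by
  obtain ⟨B, hB, hlev⟩ := norm_level_le (m := m) (d := d) (α := α) (by linarith) (by linarith) hκ0
  set ρ : ℝ := 2 ^ (-κ) with hρ
  have hρ1 : ρ < 1 := Real.rpow_lt_one_of_one_lt_of_neg one_lt_two (by linarith)
  have hρ0 : 0 < ρ := by positivity
  set C := 4 * L * B + 3 * B ^ 2 with hC
  have hC0 : 0 < C := by positivity
  have hρ' : 0 < 1 - ρ := by linarith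
  set M := 2 * C / (1 - ρ) with hMdef
  have hM0 : 0 < M := by positivity
  have hMC : M * (1 - ρ) = 2 * C := by rw [hMdef]; field_simp
  -- Below `c` the sewing estimate closes; below the second threshold `c'` the total deviation from
  -- the drift power is also at most `τ`, the room between `exp (-a)` and `exp (-a + η)`.
  obtain ⟨c, hc0, hc1, hc⟩ := exists_small_rpow_add (α := α) (by linarith) (2 * B) M
    (show 0 < (1 - ρ) / 2 by linarith)
  set τ := Real.exp (-a + η) - Real.exp (-a) with hτ
  have hτ0 : 0 < τ := sub_pos.2 (Real.exp_lt_exp.2 (by linarith))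
  obtain ⟨c', hc'0, hc'1, hc'⟩ := exists_small_rpow_add (α := α) (by linarith) (2 * B) M
    (show 0 < min τ ((1 - ρ) / 2) from lt_min hτ0 (by linarith))
  -- The first summand bounds a single step with control above `c`, the second pays `log 2` at each
  -- splitting.
  set K₀ := 2 * B * (1 / c + 1) + Real.log 2 / ((1 - ρ) * c) with hK₀
  have hlog2 : 0 < Real.log 2 := Real.log_pos one_lt_two
  have hK₀0 : 0 < K₀ := by positivity
  set c₁ := min c c' with hc₁
  have hc₁0 : 0 < c₁ := lt_min hc0 hc'0
  refine ⟨K₀ + (Real.log 2 + a) / c₁, by positivity, ?_⟩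
  intro A G δ Δ k ω s₀ hA hδ hδ1 hG hΔ hk hS hSk hs₀ hs₀2 hfin
  set v : ℕ → ℝ → ℝ := fun n s => scaledControl κ δ ω s (2 ^ n * Δ) with hv
  have hv0 : ∀ n s, 0 ≤ v n s := fun n s => scaledControl_nonneg hδ.le ω s (by positivity)
  have hlev' : ∀ s l : ℝ, 0 ≤ s → 0 ≤ l → l ≤ 1 → s + l ≤ 2 →
      ‖level1 G (ω.x s (s + l))‖ ≤ δ * (B * scaledControl κ δ ω s l ^ α) ∧
      ‖level2 G (ω.XX s (s + l))‖ ≤ δ * (B * (scaledControl κ δ ω s l ^ α) ^ 2) :=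
    fun s l hs hl hl1 hsl => hlev G δ ω s l hδ hδ1 hG hs hl hl1 (control_ne_top hfin hs hsl)
  set T := s₀ + 2 ^ k * Δ with hT
  have hpow : ∀ n : ℕ, (2 : ℝ) ^ (n + 1) * Δ = 2 * (2 ^ n * Δ) := fun n => by rw [pow_succ]; ring
  have hvadd : ∀ n s, s₀ ≤ s → s + 2 ^ (n + 1) * Δ ≤ T →
      v n s + v n (s + 2 ^ n * Δ) ≤ ρ * v (n + 1) s := by
    intro n s hs hsT
    simp only [hv]
    rw [hpow] at hsT ⊢
    exact scaledControl_add_le hδ.le hfin (by linarith) (by positivity) (by linarith)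
  have hnoise : ∀ n s, s₀ ≤ s → s + 2 ^ n * Δ ≤ T →
      ‖linNoise G ω s (s + 2 ^ n * Δ)‖ ≤ B * v n s ^ α + B * (v n s ^ α) ^ 2 := by
    intro n s hs hsT
    have hl := hlev' s (2 ^ n * Δ) (by linarith) (by positivity) (by linarith) (by linarith)
    exact norm_linNoise_le hδ1 hB (Real.rpow_nonneg (hv0 n s) _) hl.1 hl.2
  have hnoise' : ∀ n s, s₀ ≤ s → s + 2 ^ n * Δ ≤ T → v n s ≤ 1 →
      ‖linNoise G ω s (s + 2 ^ n * Δ)‖ ≤ 2 * B * v n s ^ α := by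
    intro n s hs hsT hv1
    refine (hnoise n s hs hsT).trans ?_
    have he0 : 0 ≤ v n s ^ α := Real.rpow_nonneg (hv0 n s) _
    have he1 : v n s ^ α ≤ 1 := Real.rpow_le_one (hv0 n s) hv1 (by linarith)
    have : (v n s ^ α) ^ 2 ≤ v n s ^ α := by rw [sq]; exact mul_le_of_le_one_left he0 he1
    nlinarith
  have hSn : ∀ n : ℕ, ‖(1 + Δ • A) ^ 2 ^ n‖ ≤ 1 := fun n =>
    (norm_pow_le' _ (by positivity)).trans (pow_le_one₀ (norm_nonneg _) hS)
  have hΞ : ∀ n s, s₀ ≤ s → s + 2 ^ n * Δ ≤ T → v n s ≤ c →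
      ‖linApprox G A ω Δ n s‖ ≤ 1 + 2 * B * c ^ α := by
    intro n s hs hsT hvc
    refine (norm_add_le _ _).trans (add_le_add (hSn n)
      ((hnoise' n s hs hsT (hvc.trans hc1)).trans ?_))
    have := Real.rpow_le_rpow (hv0 n s) hvc (show 0 ≤ α by linarith)
    gcongr
  have hR : ∀ n s, s₀ ≤ s → s + 2 ^ (n + 1) * Δ ≤ T → v (n + 1) s ≤ c →
      ‖linApprox G A ω Δ n (s + 2 ^ n * Δ) * linApprox G A ω Δ n s -
        linApprox G A ω Δ (n + 1) s‖ ≤ C * v (n + 1) s := fun n s hs hsT hvc =>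
    norm_linApprox_mul_sub_le hα hκ1 hB hlev' hδ hδ1 hfin hL hA hΔ hS hκ0 n s (by linarith)
      (by linarith) (by linarith) (hvc.trans hc1)
  have hcα : 0 ≤ c ^ α := by positivity
  have hMineq : C + ρ * M * (1 + 2 * B * c ^ α + M * c) ≤ M := by
    rw [add_assoc 1]
    exact sewing_const_le hρ0.le hρ1.le hM0.le hMC hc
  have hdiff := norm_dyadicProd_sub_le (Ξ := linApprox G A ω Δ) (v := v) (σ := s₀) (T := T)
    hΔ hρ1.le hM0.le (by positivity) hv0 hvadd hR hΞ hMineq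
  have hsmall : ∀ n s, s₀ ≤ s → s + 2 ^ n * Δ ≤ T → v n s ≤ c →
      ‖dyadicProd (linApprox G A ω Δ 0) Δ n s‖ ≤ 2 := by
    intro n s hs hsT hvc
    have h1 := hdiff n s hs hsT hvc
    have h2 := hΞ n s hs hsT hvc
    have h3 := norm_le_norm_add_norm_sub' (dyadicProd (linApprox G A ω Δ 0) Δ n s)
      (linApprox G A ω Δ n s)
    have h4 : M * v n s ≤ M * c := by gcongr
    linarith only [h1, h2, h3, h4, hc, hρ0]
  have hleaf : ∀ s, s₀ ≤ s → s + Δ ≤ T → c < v 0 s →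
      ‖linApprox G A ω Δ 0 s‖ ≤ Real.exp (K₀ * v 0 s) := by
    intro s hs hsT hvc
    have h1 := hnoise 0 s hs (by simpa using hsT)
    have h2 := rpow_le_one_add (hv0 0 s) (show 0 ≤ α by linarith) (by linarith)
    have h3 : (v 0 s ^ α) ^ 2 ≤ 1 + v 0 s := by
      rw [← Real.rpow_natCast, ← Real.rpow_mul (hv0 0 s)]
      exact rpow_le_one_add (hv0 0 s) (by push_cast; linarith) (by push_cast; linarith)
    have h4 : ‖linApprox G A ω Δ 0 s‖ ≤ 1 + (B * (1 + v 0 s) + B * (1 + v 0 s)) := by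
      refine (norm_add_le _ _).trans (add_le_add (hSn 0) (h1.trans ?_))
      gcongr
    have h5 : 1 + v 0 s ≤ (1 / c + 1) * v 0 s := by
      have : 1 ≤ 1 / c * v 0 s := by rw [one_div, ← div_eq_inv_mul, one_le_div hc0]; exact hvc.le
      linarith
    refine h4.trans (le_trans ?_ (Real.add_one_le_exp _))
    have h6 : 2 * B * (1 + v 0 s) ≤ 2 * B * ((1 / c + 1) * v 0 s) := by gcongr
    have h7 : 0 ≤ Real.log 2 / ((1 - ρ) * c) * v 0 s := mul_nonneg (by positivity) (hv0 0 s)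
    rw [hK₀]
    linarith
  have hKc : Real.log 2 ≤ K₀ * (1 - ρ) * c := by
    have h1 : Real.log 2 / ((1 - ρ) * c) * ((1 - ρ) * c) = Real.log 2 := by field_simp
    have h2 : 0 ≤ 2 * B * (1 / c + 1) * ((1 - ρ) * c) := by positivity
    rw [hK₀]
    linarith
  have hgrow := norm_dyadicProd_le_exp (Ξ := linApprox G A ω Δ) (v := v) (σ := s₀) (T := T) hΔ hv0
    hK₀0.le hvadd hsmall hleaf hρ1.le hKc k s₀ le_rfl le_rfl
  set V := v k s₀ with hVdef
  have hV0 : 0 ≤ V := hv0 _ _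
  have hVle : V ≤ δ * (1 + (dyadicControl κ ω 0 2).toReal) := by
    simp only [hVdef, hv, scaledControl]
    have hw : (dyadicControl κ ω s₀ (s₀ + 2 ^ k * Δ)).toReal ≤ (dyadicControl κ ω 0 2).toReal :=
      ENNReal.toReal_mono hfin (control_mono κ ω hs₀ hs₀2)
    have hw0 : 0 ≤ (dyadicControl κ ω s₀ (s₀ + 2 ^ k * Δ)).toReal := ENNReal.toReal_nonneg
    have hp : 0 < 2 ^ k * Δ := by positivity
    gcongr
    refine (mul_le_of_le_one_left (by positivity) (Real.rpow_le_one hp.le hk hκ0.le)).trans ?_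
    linarith
  rw [← linApprox_zero]
  suffices hsuff : ‖dyadicProd (linApprox G A ω Δ 0) Δ k s₀‖ ≤
      Real.exp (-a + η + (K₀ + (Real.log 2 + a) / c₁) * V) by
    refine hsuff.trans (Real.exp_le_exp.2 ?_)
    gcongr
  -- For small control the contraction of the drift survives up to `η`. For large control there is
  -- only growth, and the missing `log 2 + a` is charged to `V > c₁`.
  rcases le_or_gt V c₁ with hVc | hVc
  · have hVc1 : V ≤ c := hVc.trans (min_le_left _ _)
    have hVc2 : V ≤ c' := hVc.trans (min_le_right _ _)
    have h1 := hdiff k s₀ le_rfl le_rfl hVc1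
    have h2 := hnoise' k s₀ le_rfl le_rfl (hVc1.trans hc1)
    have h3 := norm_le_norm_add_norm_sub' (dyadicProd (linApprox G A ω Δ 0) Δ k s₀)
      (linApprox G A ω Δ k s₀)
    have h4 : ‖linApprox G A ω Δ k s₀‖ ≤ Real.exp (-a) + 2 * B * V ^ α :=
      (norm_add_le _ _).trans (add_le_add hSk h2)
    have h5 : V ^ α ≤ c' ^ α := Real.rpow_le_rpow hV0 hVc2 (by linarith)
    have h6 : 2 * B * V ^ α ≤ 2 * B * c' ^ α := by gcongr
    have h7 : M * V ≤ M * c' := by gcongr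
    have h8 := min_le_left τ ((1 - ρ) / 2)
    have h9 : ‖dyadicProd (linApprox G A ω Δ 0) Δ k s₀‖ ≤ Real.exp (-a + η) := by
      linarith only [h1, h3, h4, h6, h7, h8, hc', hτ]
    refine h9.trans (Real.exp_le_exp.2 ?_)
    have : 0 ≤ (K₀ + (Real.log 2 + a) / c₁) * V := by positivity
    linarith
  · refine hgrow.trans ?_
    have h1 : Real.log 2 + a ≤ (Real.log 2 + a) / c₁ * V := by
      rw [div_mul_eq_mul_div, le_div_iff₀ hc₁0]
      gcongr
    calc 2 * Real.exp (K₀ * V) = Real.exp (Real.log 2 + K₀ * V) := by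
          rw [Real.exp_add, Real.exp_log two_pos]
      _ ≤ _ := Real.exp_le_exp.2 (by linarith)

/-! ### The nonlinear scheme near the fixed point -/

/-- Expanding the square gives `1 - 2 λ Δ + Δ² L²`. The step-size restriction lets half of the
dissipation absorb the last term, leaving `1 - λ Δ ≤ exp (-λ Δ)`. -/
lemma norm_one_add_smul_le {A : Vec d →L[ℝ] Vec d} {lam L Δ : ℝ} (hA : ‖A‖ ≤ L)
    (hneg : ∀ y : Vec d, inner ℝ y (A y) ≤ -lam * ‖y‖ ^ 2) (hΔ : 0 ≤ Δ) (hΔ1 : Δ * L ^ 2 ≤ lam) :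
    ‖(1 : Vec d →L[ℝ] Vec d) + Δ • A‖ ≤ Real.exp (-(lam / 2 * Δ)) := by
  refine ContinuousLinearMap.opNorm_le_bound _ (by positivity) fun y => ?_
  refine le_of_sq_le_sq ?_ (by positivity)
  have h1 : ‖A y‖ ≤ L * ‖y‖ := A.le_of_opNorm_le hA y
  have h2 : ‖A y‖ ^ 2 ≤ L ^ 2 * ‖y‖ ^ 2 := by rw [← mul_pow]; gcongr
  have e : ((1 : Vec d →L[ℝ] Vec d) + Δ • A) y = y + Δ • A y := by simp
  rw [e, norm_add_sq_real, real_inner_smul_right, norm_smul, Real.norm_of_nonneg hΔ, mul_pow,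
    mul_pow (Real.exp _), ← Real.exp_nat_mul]
  have h3 : 1 - lam * Δ ≤ Real.exp (((2 : ℕ) : ℝ) * -(lam / 2 * Δ)) := by
    have := Real.add_one_le_exp (((2 : ℕ) : ℝ) * -(lam / 2 * Δ))
    push_cast at this ⊢
    linarith
  calc ‖y‖ ^ 2 + 2 * (Δ * inner ℝ y (A y)) + Δ ^ 2 * ‖A y‖ ^ 2
      ≤ ‖y‖ ^ 2 + 2 * (Δ * (-lam * ‖y‖ ^ 2)) + Δ ^ 2 * (L ^ 2 * ‖y‖ ^ 2) := by
        gcongr; exact hneg y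
    _ = (1 - 2 * lam * Δ + Δ * (Δ * L ^ 2)) * ‖y‖ ^ 2 := by ring
    _ ≤ (1 - 2 * lam * Δ + Δ * lam) * ‖y‖ ^ 2 := by gcongr
    _ = (1 - lam * Δ) * ‖y‖ ^ 2 := by ring
    _ ≤ _ := by gcongr

/-- The size of the linearization error of the coefficients at `y` is at most `ρ`. -/
structure LinearizationBound (ε₀ : ℝ) (f : Vec d → Vec d) (g : Vec d → Vec m →L[ℝ] Vec d)
    (ρ : ℝ) (y : Vec d) : Prop where
  drift : ‖f y - fderiv ℝ f 0 y‖ ≤ ρ * ‖y‖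
  diffusion : ‖g y - fderiv ℝ g 0 y‖ ≤ ρ * ‖y‖
  deriv : ‖fderivWithin ℝ g (Metric.closedBall 0 ε₀) y - fderiv ℝ g 0‖ ≤ ρ

lemma eventually_norm_fderiv_sub_lt {E F : Type*} [NormedAddCommGroup E] [NormedSpace ℝ E]
    [NormedAddCommGroup F] [NormedSpace ℝ F] {g : E → F} {x : E} (hg : ContDiffAt ℝ 1 g x)
    {ρ : ℝ} (hρ : 0 < ρ) : ∀ᶠ y in 𝓝 x, ‖fderiv ℝ g y - fderiv ℝ g x‖ < ρ := by
  have h := Metric.tendsto_nhds.1 (hg.continuousAt_fderiv one_ne_zero).tendsto ρ hρ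
  simpa only [dist_eq_norm] using h

lemma exists_linearizationBound {ε₀ : ℝ} (hε₀ : 0 < ε₀) {f : Vec d → Vec d}
    {g : Vec d → Vec m →L[ℝ] Vec d} (hf : ContDiffOn ℝ 1 f (Metric.closedBall 0 ε₀))
    (hg : DiffusionHyp ε₀ g) (hf0 : f 0 = 0) (hg0 : g 0 = 0) {ρ : ℝ} (hρ : 0 < ρ) :
    ∃ r, 0 < r ∧ r ≤ ε₀ ∧ ∀ y : Vec d, ‖y‖ ≤ r → LinearizationBound ε₀ f g ρ y := by
  have hball : Metric.closedBall (0 : Vec d) ε₀ ∈ 𝓝 0 := Metric.closedBall_mem_nhds _ hε₀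
  have hfd := ((hf.contDiffAt hball).differentiableAt (by norm_num)).hasFDerivAt
  have hgc : ContDiffAt ℝ 3 g 0 := ContDiffOn.contDiffAt hg hball
  have hgd := (hgc.differentiableAt (by norm_num)).hasFDerivAt
  have e1 := hfd.isLittleO.def hρ
  have e2 := hgd.isLittleO.def hρ
  have e3 := eventually_norm_fderiv_sub_lt (hgc.of_le (by norm_num)) hρ
  have e4 : ∀ᶠ y in 𝓝 (0 : Vec d), y ∈ Metric.ball (0 : Vec d) ε₀ := Metric.ball_mem_nhds _ hε₀
  obtain ⟨r, hr, h⟩ := Metric.eventually_nhds_iff.1 (e1.and (e2.and (e3.and e4)))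
  refine ⟨min (r / 2) ε₀, by positivity, min_le_right _ _, fun y hy => ?_⟩
  have hyr : dist y 0 < r := by
    rw [dist_zero_right]
    have := hy.trans (min_le_left _ _)
    linarith
  obtain ⟨h1, h2, h3, h4⟩ := h hyr
  simp only [hf0, hg0, sub_zero] at h1 h2
  refine ⟨h1, h2, ?_⟩
  rw [fderivWithin_of_mem_nhds (mem_of_superset (Metric.isOpen_ball.mem_nhds h4)
    Metric.ball_subset_closedBall)]
  exact h3.le

lemma norm_step_sub_linStep_le {ε₀ ρ Δ s : ℝ} {f : Vec d → Vec d}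
    {g : Vec d → Vec m →L[ℝ] Vec d} {y : Vec d} (h : LinearizationBound ε₀ f g ρ y)
    (hρ0 : 0 ≤ ρ) (hρ1 : ρ ≤ 1) (hG : ‖fderiv ℝ g 0‖ ≤ 1) (hΔ : 0 ≤ Δ) (ω : PathSpace m α) :
    ‖step ε₀ f g ω s (s + Δ) y - linStep (fderiv ℝ g 0) (fderiv ℝ f 0) ω Δ s y‖ ≤
      ρ * (Δ + ‖ω.x s (s + Δ)‖ + 3 * m ^ 2 * ‖ω.XX s (s + Δ)‖) * ‖y‖ := by
  set G := fderiv ℝ g 0 with hGdef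
  set A := fderiv ℝ f 0 with hAdef
  set D := fderivWithin ℝ g (Metric.closedBall 0 ε₀) y with hD
  set x := ω.x s (s + Δ)
  set X := ω.XX s (s + Δ)
  have hsec : ‖secondOrder ε₀ g y X - level2 G X y‖ ≤ 3 * m ^ 2 * ‖X‖ * (ρ * ‖y‖) := by
    have e : secondOrder ε₀ g y X - level2 G X y = ∑ i : Fin m, ∑ j : Fin m, X (i, j) •
        ((D (g y (EuclideanSpace.single i 1))) (EuclideanSpace.single j 1) -
          (G (G y (EuclideanSpace.single i 1))) (EuclideanSpace.single j 1)) := by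
      simp only [smul_sub, Finset.sum_sub_distrib]
      simp [secondOrder, level2, level1, hD]
    rw [e]
    have hterm : ∀ i j : Fin m, ‖X (i, j) •
        ((D (g y (EuclideanSpace.single i 1))) (EuclideanSpace.single j 1) -
          (G (G y (EuclideanSpace.single i 1))) (EuclideanSpace.single j 1))‖ ≤
        ‖X‖ * (3 * (ρ * ‖y‖)) := by
      intro i j
      rw [norm_smul]
      refine mul_le_mul (PiLp.norm_apply_le X (i, j)) ?_ (norm_nonneg _) (norm_nonneg X)
      set ei : Vec m := EuclideanSpace.single i 1
      set ej : Vec m := EuclideanSpace.single j 1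
      have hei : ‖ei‖ = 1 := by simp [ei]
      have hej : ‖ej‖ = 1 := by simp [ej]
      -- Replacing `Dg(y)` costs `ρ` times `‖g y ei‖ ≤ 2 ‖y‖`, replacing `g y` costs `ρ ‖y‖`:
      -- together the factor three.
      have e2 : (D (g y ei)) ej - (G (G y ei)) ej =
          ((D - G) (g y ei)) ej + (G ((g y - G y) ei)) ej := by
        simp
      have hgy : ‖g y ei‖ ≤ 2 * ‖y‖ := by
        have h1 : ‖g y‖ ≤ ρ * ‖y‖ + ‖G y‖ := by
          have := norm_le_norm_sub_add (g y) (G y)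
          linarith [h.diffusion]
        have h2 : ‖G y‖ ≤ 1 * ‖y‖ := G.le_of_opNorm_le hG y
        have h3 : ρ * ‖y‖ ≤ 1 * ‖y‖ := by gcongr
        have h4 := (g y).le_opNorm ei
        rw [hei, mul_one] at h4
        linarith
      have t1 : ‖((D - G) (g y ei)) ej‖ ≤ ρ * (2 * ‖y‖) := by
        have h1 := ((D - G) (g y ei)).le_opNorm ej
        rw [hej, mul_one] at h1
        exact h1.trans (((D - G).le_of_opNorm_le h.deriv _).trans (by gcongr))
      have t2 : ‖(G ((g y - G y) ei)) ej‖ ≤ ρ * ‖y‖ := by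
        have h1 := (G ((g y - G y) ei)).le_opNorm ej
        have h2 := (g y - G y).le_opNorm ei
        rw [hej, mul_one] at h1
        rw [hei, mul_one] at h2
        have h3 := G.le_of_opNorm_le hG ((g y - G y) ei)
        linarith [h.diffusion]
      rw [e2]
      refine (norm_add_le _ _).trans ?_
      linarith
    calc _ ≤ ∑ i : Fin m, ∑ j : Fin m, ‖X‖ * (3 * (ρ * ‖y‖)) :=
          (norm_sum_le _ _).trans (Finset.sum_le_sum fun i _ =>
            (norm_sum_le _ _).trans (Finset.sum_le_sum fun j _ => hterm i j))
      _ = _ := by simp; ring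
  have e : step ε₀ f g ω s (s + Δ) y - linStep G A ω Δ s y =
      Δ • (f y - A y) + (g y - G y) x + (secondOrder ε₀ g y X - level2 G X y) := by
    have : linStep G A ω Δ s y = y + Δ • A y + (G y x + level2 G X y) := by
      simp [linStep, linNoise, level1, x, X]
    rw [this]
    simp only [step, sub_apply, smul_sub, add_sub_cancel_left, x, X]
    abel
  rw [e]
  have h1 : ‖Δ • (f y - A y)‖ ≤ Δ * (ρ * ‖y‖) := by
    rw [norm_smul, Real.norm_of_nonneg hΔ]
    exact mul_le_mul_of_nonneg_left h.drift hΔ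
  have h2 : ‖(g y - G y) x‖ ≤ ρ * ‖y‖ * ‖x‖ := (g y - G y).le_of_opNorm_le h.diffusion x
  refine norm_add₃_le.trans ((add_le_add (add_le_add h1 h2) hsec).trans (le_of_eq ?_))
  ring

/-- A linear orbit over `2 ^ n` steps is given by the dyadic product. -/
lemma dyadicProd_apply {Ξ : ℝ → Vec d →L[ℝ] Vec d} {Δ : ℝ} (n : ℕ) : ∀ (s : ℝ) (z : ℕ → Vec d),
    (∀ j, z (j + 1) = Ξ (s + j * Δ) (z j)) → z (2 ^ n) = dyadicProd Ξ Δ n s (z 0) := by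
  induction n with
  | zero =>
    intro s z hz
    simpa [dyadicProd] using hz 0
  | succ n ih =>
    intro s z hz
    have h1 := ih s z hz
    have h2 := ih (s + 2 ^ n * Δ) (fun j => z (2 ^ n + j)) fun j => by
      rw [← add_assoc, hz]
      congr 2
      push_cast
      ring
    change _ = dyadicProd Ξ Δ n (s + 2 ^ n * Δ) (dyadicProd Ξ Δ n s (z 0))
    rw [← h1, pow_succ, mul_two]
    exact h2

/-- An orbit that starts close enough to zero is approximated by the linear orbit. -/
lemma norm_orbit_le {Ξ : ℝ → Vec d →L[ℝ] Vec d} {Δ s r ρ Z : ℝ} {F : ℕ → Vec d → Vec d}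
    {y : ℕ → Vec d} (k : ℕ) (hρ0 : 0 ≤ ρ) (hρ1 : ρ ≤ 1) (hZ : 1 ≤ Z)
    (hF : ∀ j : ℕ, j < 2 ^ k → ∀ u, ‖u‖ ≤ r → ‖F j u - Ξ (s + j * Δ) u‖ ≤ ρ * Z * ‖u‖)
    (hΞ : ∀ j : ℕ, j < 2 ^ k → ‖Ξ (s + j * Δ)‖ ≤ Z)
    (hy : ∀ j : ℕ, j < 2 ^ k → y (j + 1) = F j (y j))
    (hr : (3 * Z) ^ 2 ^ k * ‖y 0‖ ≤ r) :
    (∀ j ≤ 2 ^ k, ‖y j‖ ≤ (3 * Z) ^ 2 ^ k * ‖y 0‖) ∧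
      ‖y (2 ^ k)‖ ≤ (‖dyadicProd Ξ Δ k s‖ + ρ * (3 * Z) ^ 2 ^ k) * ‖y 0‖ := by
  set z : ℕ → Vec d := fun j => Nat.rec (y 0) (fun i u => Ξ (s + i * Δ) u) j with hz
  have hzs : ∀ j, z (j + 1) = Ξ (s + j * Δ) (z j) := fun j => rfl
  have hpow : ∀ j ≤ 2 ^ k, (3 * Z) ^ j * ‖y 0‖ ≤ (3 * Z) ^ 2 ^ k * ‖y 0‖ := fun j hj => by
    gcongr
    linarith
  -- Growth per step is at most `(1 + ρ) Z ≤ 3 Z`, and the deviation gains `ρ Z` from linearization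
  -- plus `ρ Z` inherited. The crude power `2 ^ k` is harmless, as `k` is fixed here.
  have key : ∀ j ≤ 2 ^ k, ‖y j‖ ≤ (3 * Z) ^ j * ‖y 0‖ ∧
      ‖y j - z j‖ ≤ ρ * (3 * Z) ^ j * ‖y 0‖ := by
    intro j
    induction j with
    | zero => intro _; simp [hz]; positivity
    | succ j ih =>
      intro hj
      have hlt : j < 2 ^ k := hj
      obtain ⟨h1, h2⟩ := ih hlt.le
      have hle := h1.trans ((hpow j hlt.le).trans hr)
      have h3 := hF j hlt (y j) hle
      have h4 := hΞ j hlt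
      rw [hy j hlt, hzs]
      set P := (3 * Z) ^ j * ‖y 0‖ with hP
      have hP0 : 0 ≤ P := by positivity
      have hPs : (3 * Z) ^ (j + 1) * ‖y 0‖ = 3 * Z * P := by rw [pow_succ, hP]; ring
      have h3' : ‖F j (y j) - Ξ (s + j * Δ) (y j)‖ ≤ ρ * Z * P := h3.trans (by gcongr)
      constructor
      · rw [hPs]
        have h5 : ‖Ξ (s + j * Δ) (y j)‖ ≤ Z * P :=
          ((Ξ (s + j * Δ)).le_of_opNorm_le h4 _).trans (by gcongr)
        have h6 : ρ * Z * P ≤ 1 * Z * P := by gcongr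
        have h7 := norm_le_norm_sub_add (F j (y j)) (Ξ (s + j * Δ) (y j))
        have h8 : 0 ≤ Z * P := by positivity
        linarith
      · have e : F j (y j) - Ξ (s + j * Δ) (z j) =
            (F j (y j) - Ξ (s + j * Δ) (y j)) + Ξ (s + j * Δ) (y j - z j) := by
          rw [map_sub]; abel
        have h5 : ‖Ξ (s + j * Δ) (y j - z j)‖ ≤ Z * (ρ * (3 * Z) ^ j * ‖y 0‖) :=
          ((Ξ (s + j * Δ)).le_of_opNorm_le h4 _).trans (by gcongr)
        rw [e]
        refine (norm_add_le _ _).trans ((add_le_add h3' h5).trans ?_)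
        have h6 : 0 ≤ ρ * Z * P := by positivity
        have e2 : ρ * (3 * Z) ^ (j + 1) * ‖y 0‖ = 3 * (ρ * Z * P) := by
          rw [pow_succ, hP]; ring
        have e3 : Z * (ρ * (3 * Z) ^ j * ‖y 0‖) = ρ * Z * P := by rw [hP]; ring
        rw [e2, e3]
        linarith
  refine ⟨fun j hj => (key j hj).1.trans (hpow j hj), ?_⟩
  have h1 := (key _ le_rfl).2
  have h2 := dyadicProd_apply k s z hzs
  have h3 : ‖z (2 ^ k)‖ ≤ ‖dyadicProd Ξ Δ k s‖ * ‖y 0‖ := by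
    rw [h2]; exact ContinuousLinearMap.le_opNorm _ _
  have h4 := norm_le_norm_sub_add (y (2 ^ k)) (z (2 ^ k))
  linarith

/-- One step of the scheme over a window in which the noise is controlled. -/
lemma exists_step_bound (hα : 0 < α) (hα2 : α ≤ 1 / 2) {κ : ℝ} (hκ : 0 < κ) :
    ∃ C : ℝ, 1 ≤ C ∧ ∀ (ω : PathSpace m α) (Δ s : ℝ), dyadicControl κ ω 0 2 ≠ ∞ → 0 ≤ s → 0 < Δ →
      Δ ≤ 1 → s + Δ ≤ 2 → ∀ (A : Vec d →L[ℝ] Vec d) (G : Vec d →L[ℝ] Vec m →L[ℝ] Vec d),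
      ‖1 + Δ • A‖ ≤ 1 → ‖G‖ ≤ 1 →
      ‖linStep G A ω Δ s‖ ≤ C * (1 + (dyadicControl κ ω 0 2).toReal) ∧
      Δ + ‖ω.x s (s + Δ)‖ + 3 * m ^ 2 * ‖ω.XX s (s + Δ)‖ ≤
        C * (1 + (dyadicControl κ ω 0 2).toReal) := by
  obtain ⟨C, hC, h⟩ := norm_le_control (m := m) hα hκ
  refine ⟨1 + C + 3 * m ^ 2 * C, by nlinarith [sq_nonneg (m : ℝ)], ?_⟩
  intro ω Δ s hfin hs hΔ hΔ1 hsΔ A G hA hG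
  obtain ⟨h1, h2⟩ := h ω s (s + Δ) hs (by linarith) (by linarith) (control_ne_top hfin hs hsΔ)
  rw [add_sub_cancel_left] at h1 h2
  set w := (dyadicControl κ ω s (s + Δ)).toReal with hw
  set W := (dyadicControl κ ω 0 2).toReal with hW
  have hw0 : 0 ≤ w := ENNReal.toReal_nonneg
  have hwW : w ≤ W := ENNReal.toReal_mono hfin (control_mono κ ω hs hsΔ)
  have hu0 : 0 ≤ Δ ^ κ * w := by positivity
  have hu : Δ ^ κ * w ≤ W :=
    (mul_le_of_le_one_left hw0 (Real.rpow_le_one hΔ.le hΔ1 hκ.le)).trans hwW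
  have a1 : (Δ ^ κ * w) ^ α ≤ 1 + W :=
    (rpow_le_one_add hu0 hα.le (by linarith)).trans (by linarith)
  have a2 : ((Δ ^ κ * w) ^ α) ^ 2 ≤ 1 + W := by
    rw [← Real.rpow_natCast, ← Real.rpow_mul hu0]
    exact (rpow_le_one_add hu0 (by positivity) (by push_cast; linarith)).trans (by linarith)
  have b1 : ‖ω.x s (s + Δ)‖ ≤ C * (1 + W) := h1.trans (by gcongr)
  have b2 : ‖ω.XX s (s + Δ)‖ ≤ C * (1 + W) := h2.trans (by gcongr)
  have hm : (0 : ℝ) ≤ m ^ 2 := by positivity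
  have b3 : (m : ℝ) ^ 2 * ‖ω.XX s (s + Δ)‖ ≤ m ^ 2 * (C * (1 + W)) := by gcongr
  have hW0 : 0 ≤ W := hw0.trans hwW
  have b4 : 0 ≤ (m : ℝ) ^ 2 * (C * (1 + W)) := by positivity
  constructor
  · have c1 : ‖level1 G (ω.x s (s + Δ))‖ ≤ 1 * ‖ω.x s (s + Δ)‖ :=
      (norm_level1_le G _).trans (by gcongr)
    have c2 : ‖level2 G (ω.XX s (s + Δ))‖ ≤ m ^ 2 * (1 * ‖ω.XX s (s + Δ)‖) :=
      (norm_level2_le G _).trans (by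
        have : ‖G‖ ^ 2 ≤ 1 := pow_le_one₀ (norm_nonneg G) hG
        gcongr)
    refine (norm_add_le _ _).trans ((add_le_add hA (norm_add_le _ _)).trans ?_)
    linarith
  · linarith

/-! ### Growth rates of blocks -/

/-- The growth rate of the scheme over a block, as a function of the control of the noise. -/
noncomputable def growthRate (c C : ℝ) (R : ℕ) (w : ℝ≥0∞) : ℝ≥0∞ :=
  ENNReal.ofReal c * (1 + w) + if (R : ℝ≥0∞) < w then ENNReal.ofReal C * (1 + w) else 0

lemma measurable_growthRate (c C : ℝ) (R : ℕ) : Measurable (growthRate c C R) :=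
  ((measurable_id.const_add _).const_mul _).add
    (Measurable.ite measurableSet_Ioi ((measurable_id.const_add _).const_mul _) measurable_const)

lemma toReal_growthRate {c C : ℝ} (hc : 0 ≤ c) (hC : 0 ≤ C) (R : ℕ) {w : ℝ≥0∞} (hw : w ≠ ∞) :
    (growthRate c C R w).toReal =
      c * (1 + w.toReal) + if (R : ℝ) < w.toReal then C * (1 + w.toReal) else 0 := by
  have h1 : (1 + w).toReal = 1 + w.toReal := by rw [ENNReal.toReal_add (by simp) hw]; simp
  have hlt : (R : ℝ≥0∞) < w ↔ (R : ℝ) < w.toReal := by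
    rw [← ENNReal.toReal_lt_toReal (by simp) hw]; simp
  unfold growthRate
  rw [ENNReal.toReal_add (by finiteness) (by split_ifs <;> finiteness)]
  simp only [hlt]
  split_ifs <;> simp [ENNReal.toReal_mul, h1, ENNReal.toReal_ofReal hc, ENNReal.toReal_ofReal hC]

lemma ne_top_of_growthRate_ne_top {c C : ℝ} (hc : 0 < c) {R : ℕ} {w : ℝ≥0∞}
    (h : growthRate c C R w ≠ ∞) : w ≠ ∞ := by
  rintro rfl
  apply h
  simp [growthRate, ENNReal.mul_top, hc]

lemma exists_tail_lintegral_lt {Ω : Type*} [MeasurableSpace Ω] {P : Measure Ω}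
    [IsProbabilityMeasure P] {w : Ω → ℝ≥0∞} (hw : Measurable w) (hfin : ∫⁻ ω, w ω ∂P < ∞) (C : ℝ)
    {ε : ℝ≥0∞} (hε : 0 < ε) :
    ∃ R : ℕ, ∫⁻ ω, (if (R : ℝ≥0∞) < w ω then ENNReal.ofReal C * (1 + w ω) else 0) ∂P < ε := by
  have hlim : Tendsto (fun R : ℕ => ∫⁻ ω, (if (R : ℝ≥0∞) < w ω then
      ENNReal.ofReal C * (1 + w ω) else 0) ∂P) atTop (𝓝 (∫⁻ _, 0 ∂P)) := by
    refine tendsto_lintegral_of_dominated_convergence (fun ω => ENNReal.ofReal C * (1 + w ω))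
      (fun R => Measurable.ite (measurableSet_lt measurable_const hw)
        ((hw.const_add _).const_mul _) measurable_const) (fun R => Eventually.of_forall fun ω => ?_)
      ?_ ?_
    · dsimp only
      split_ifs
      · exact le_rfl
      · exact zero_le
    · rw [lintegral_const_mul _ (hw.const_add _), lintegral_add_left measurable_const]
      simp only [lintegral_const, measure_univ, mul_one]
      finiteness
    · filter_upwards [ae_lt_top hw hfin.ne] with ω hω
      obtain ⟨n, hn⟩ := ENNReal.exists_nat_gt hω.ne
      refine tendsto_const_nhds.congr' ?_
      filter_upwards [eventually_ge_atTop n] with R hR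
      rw [if_neg]
      rw [not_lt]
      exact hn.le.trans (by exact_mod_cast hR)
  rw [lintegral_zero] at hlim
  exact (hlim.eventually (gt_mem_nhds hε)).exists

/-- The linear part uses half of the budget `μ`; dominated convergence makes the truncated part
smaller than the other half. -/
lemma lintegral_growthRate_lt {Ω : Type*} [MeasurableSpace Ω] {P : Measure Ω}
    [IsProbabilityMeasure P] {w : Ω → ℝ≥0∞} (hw : Measurable w) (hfin : ∫⁻ ω, w ω ∂P < ∞)
    {c μ : ℝ} (hμ : 0 < μ) (hc : ENNReal.ofReal c * (1 + ∫⁻ ω, w ω ∂P) ≤ ENNReal.ofReal (μ / 2))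
    (C : ℝ) : ∃ R : ℕ, ∫⁻ ω, growthRate c C R (w ω) ∂P < ENNReal.ofReal μ := by
  obtain ⟨R, hR⟩ := exists_tail_lintegral_lt hw hfin C
    (show 0 < ENNReal.ofReal (μ / 2) from ENNReal.ofReal_pos.2 (by linarith))
  refine ⟨R, ?_⟩
  unfold growthRate
  rw [lintegral_add_left ((hw.const_add _).const_mul _), lintegral_const_mul _ (hw.const_add _),
    lintegral_add_left measurable_const]
  simp only [lintegral_const, measure_univ, mul_one]
  calc _ < ENNReal.ofReal (μ / 2) + ENNReal.ofReal (μ / 2) :=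
        ENNReal.add_lt_add_of_le_of_lt (ne_top_of_le_ne_top ENNReal.ofReal_ne_top hc) hc hR
    _ = ENNReal.ofReal μ := by
        rw [← ENNReal.ofReal_add (by linarith) (by linarith)]; congr 1; ring

/-- For `w ≤ R` the nonlinear error fits between `exp (-a + η)` and `exp (-a + 2η)`. For `w > R` the
tail term covers it: in `C + a + 1` the `a` undoes the contraction, and the `1` absorbs a sum of two
exponentials because `2 ≤ e`. -/
lemma exp_add_le_exp_growthRate {a η c ρ C : ℝ} {R : ℕ} {w : ℝ≥0∞} (hw : w ≠ ∞) (ha : 0 ≤ a)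
    (hη : 0 < η) (hc : 0 ≤ c) (hρ0 : 0 ≤ ρ) (hρ1 : ρ ≤ 1) (hC : 0 ≤ C)
    (hρ : ρ * Real.exp (C * (1 + R)) ≤ Real.exp (-a + 2 * η) - Real.exp (-a + η)) :
    Real.exp (-a + η + c * (1 + w.toReal)) + ρ * Real.exp (C * (1 + w.toReal)) ≤
      Real.exp (-a + 2 * η + (growthRate c (C + a + 1) R w).toReal) := by
  rw [toReal_growthRate hc (by linarith) R hw]
  set W := w.toReal
  have hW : 0 ≤ W := ENNReal.toReal_nonneg
  have hcW : 0 ≤ c * (1 + W) := by positivity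
  split_ifs with h
  · set T := -a + 2 * η + (c * (1 + W) + (C + a + 1) * (1 + W)) with hT
    have p1 : 0 ≤ C * W := by positivity
    have p2 : 0 ≤ a * W := by positivity
    have h1 : Real.exp (-a + η + c * (1 + W)) ≤ Real.exp (T - 1) :=
      Real.exp_le_exp.2 (by rw [hT]; nlinarith)
    have h2 : ρ * Real.exp (C * (1 + W)) ≤ 1 * Real.exp (T - 1) :=
      mul_le_mul hρ1 (Real.exp_le_exp.2 (by rw [hT]; nlinarith)) (Real.exp_pos _).le zero_le_one
    have h3 : Real.exp T = Real.exp 1 * Real.exp (T - 1) := by rw [← Real.exp_add]; ring_nf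
    have h4 : 2 ≤ Real.exp 1 := by linarith [Real.add_one_le_exp (1 : ℝ)]
    have h5 := mul_le_mul_of_nonneg_right h4 (Real.exp_pos (T - 1)).le
    linarith
  · rw [not_lt] at h
    rw [add_zero, Real.exp_add, Real.exp_add (-a + 2 * η)]
    have h1 : 1 ≤ Real.exp (c * (1 + W)) := Real.one_le_exp hcW
    have h2 : ρ * Real.exp (C * (1 + W)) ≤ ρ * Real.exp (C * (1 + R)) := by gcongr
    have h3 : 0 ≤ Real.exp (-a + 2 * η) - Real.exp (-a + η) := le_trans (by positivity) hρ
    nlinarith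

lemma exp_le_exp_growthRate {a c C : ℝ} {R : ℕ} {w : ℝ≥0∞} (hw : w ≠ ∞) (ha : 0 ≤ a)
    (hc : 0 ≤ c) (hC : 0 ≤ C) :
    Real.exp (C * (1 + w.toReal)) ≤
      Real.exp (C * (1 + R) + (growthRate c (C + a + 1) R w).toReal) := by
  rw [toReal_growthRate hc (by linarith) R hw, Real.exp_le_exp]
  set W := w.toReal
  have hW : 0 ≤ W := ENNReal.toReal_nonneg
  have hcW : 0 ≤ c * (1 + W) := by positivity
  have h1 : 0 ≤ C * (1 + R) := by positivity
  split_ifs with h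
  · have h2 : C * (1 + W) ≤ (C + a + 1) * (1 + W) := by
      gcongr
      linarith
    linarith
  · have h2 : C * (1 + W) ≤ C * (1 + R) := by
      gcongr
      exact not_lt.1 h
    linarith

lemma step_shift (ε₀ : ℝ) (f : Vec d → Vec d) (g : Vec d → Vec m →L[ℝ] Vec d)
    (ω : PathSpace m α) (v s t : ℝ) :
    step ε₀ f g (shift v ω) s t = step ε₀ f g ω (v + s) (v + t) := by
  funext y
  simp only [step, shift_x, shift_XX, add_sub_add_left_eq_sub]

/-- Growth of the nonlinear scheme over a block, as long as it stays close to zero. -/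
lemma exists_block_bound (hα : 0 < α) (hα2 : α ≤ 1 / 2) {κ : ℝ} (hκ : 0 < κ) (k : ℕ) :
    ∃ C : ℝ, 0 < C ∧ ∀ (ε₀ : ℝ) (f : Vec d → Vec d) (g : Vec d → Vec m →L[ℝ] Vec d)
      (ω : PathSpace m α) (Δ s ρ r : ℝ) (y : ℕ → Vec d), dyadicControl κ ω 0 2 ≠ ∞ → 0 ≤ s → 0 < Δ →
      Δ ≤ 1 → s + 2 ^ k * Δ ≤ 2 → ‖1 + Δ • fderiv ℝ f 0‖ ≤ 1 → ‖fderiv ℝ g 0‖ ≤ 1 →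
      0 ≤ ρ → ρ ≤ 1 → (∀ u : Vec d, ‖u‖ ≤ r → LinearizationBound ε₀ f g ρ u) →
      (∀ j : ℕ, j < 2 ^ k → y (j + 1) = step ε₀ f g ω (s + j * Δ) (s + j * Δ + Δ) (y j)) →
      Real.exp (C * (1 + (dyadicControl κ ω 0 2).toReal)) * ‖y 0‖ ≤ r →
      (∀ j ≤ 2 ^ k, ‖y j‖ ≤ Real.exp (C * (1 + (dyadicControl κ ω 0 2).toReal)) * ‖y 0‖) ∧
      ‖y (2 ^ k)‖ ≤ (‖dyadicProd (linStep (fderiv ℝ g 0) (fderiv ℝ f 0) ω Δ) Δ k s‖ +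
        ρ * Real.exp (C * (1 + (dyadicControl κ ω 0 2).toReal))) * ‖y 0‖ := by
  obtain ⟨C, hC1, hC⟩ := exists_step_bound (m := m) (d := d) hα hα2 hκ
  refine ⟨2 ^ k * (3 * C), by positivity, ?_⟩
  intro ε₀ f g ω Δ s ρ r y hfin hs hΔ hΔ1 hs2 hA hG hρ0 hρ1 hlin hy hr
  set W := (dyadicControl κ ω 0 2).toReal
  have hW : 0 ≤ W := ENNReal.toReal_nonneg
  set Z := C * (1 + W) with hZ
  have hZ1 : 1 ≤ Z := by rw [hZ]; nlinarith
  have hexp : (3 * Z) ^ 2 ^ k ≤ Real.exp (2 ^ k * (3 * C) * (1 + W)) := by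
    have h1 : 3 * Z ≤ Real.exp (3 * Z) := by linarith [Real.add_one_le_exp (3 * Z)]
    calc (3 * Z) ^ 2 ^ k ≤ Real.exp (3 * Z) ^ 2 ^ k := by gcongr
      _ = _ := by rw [← Real.exp_nat_mul]; congr 1; push_cast; rw [hZ]; ring
  have hpos : ∀ j : ℕ, j < 2 ^ k → 0 ≤ s + j * Δ ∧ s + j * Δ + Δ ≤ 2 := by
    intro j hj
    have h1 : ((j : ℝ) + 1) ≤ 2 ^ k := by exact_mod_cast hj
    have h2 : ((j : ℝ) + 1) * Δ ≤ 2 ^ k * Δ := by gcongr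
    have h3 : 0 ≤ (j : ℝ) * Δ := by positivity
    constructor <;> linarith
  have hstep := fun j hj => hC ω Δ (s + (j : ℕ) * Δ) hfin (hpos j hj).1 hΔ hΔ1 (hpos j hj).2
    (fderiv ℝ f 0) (fderiv ℝ g 0) hA hG
  have hmain := norm_orbit_le (Ξ := linStep (fderiv ℝ g 0) (fderiv ℝ f 0) ω Δ) (Δ := Δ) (s := s)
    (r := r) (F := fun j => step ε₀ f g ω (s + j * Δ) (s + j * Δ + Δ)) (y := y) k hρ0 hρ1 hZ1
    (fun j hj u hu => (norm_step_sub_linStep_le (hlin u hu) hρ0 hρ1 hG hΔ.le ω).trans (by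
      have := (hstep j hj).2
      gcongr)) (fun j hj => (hstep j hj).1) hy
    (le_trans (by gcongr) hr)
  refine ⟨fun j hj => (hmain.1 j hj).trans (by gcongr), hmain.2.trans (by gcongr)⟩

/-- From block estimates to exponential decay. -/
lemma norm_le_of_block {E : Type*} [NormedAddCommGroup E] {y : ℕ → E} {N : ℕ} {e : ℕ → ℝ}
    {b K μ r r₀ : ℝ} (hμ : 0 ≤ μ) (hr : 0 ≤ r) (hrr : r ≤ r₀)
    (hblock : ∀ n, Real.exp (b + e n) * ‖y (n * N)‖ ≤ r₀ →
      (∀ j ≤ N, ‖y (n * N + j)‖ ≤ Real.exp (b + e n) * ‖y (n * N)‖) ∧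
      ‖y (n * N + N)‖ ≤ Real.exp (-(4 * μ) + e n) * ‖y (n * N)‖)
    (he : ∀ n, ∑ i ∈ Finset.range n, e i ≤ K + 2 * μ * n)
    (h0 : ‖y 0‖ ≤ r * Real.exp (-(b + 2 * μ + K))) (n : ℕ) :
    ∀ j ≤ N, ‖y (n * N + j)‖ ≤ r * Real.exp (-(2 * μ * n)) := by
  have hkey : ∀ n, ‖y (n * N)‖ ≤
      Real.exp (-(4 * μ * n) + ∑ i ∈ Finset.range n, e i) * ‖y 0‖ →
      Real.exp (b + e n) * ‖y (n * N)‖ ≤ r * Real.exp (-(2 * μ * n)) := by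
    intro n hn
    -- The sum up to `n + 1` also accounts for the overshoot `e n` inside the current block, whence
    -- the extra `2 * μ` in the initial radius.
    have h1 := he (n + 1)
    rw [Finset.sum_range_succ] at h1
    push_cast at h1
    calc Real.exp (b + e n) * ‖y (n * N)‖
        ≤ Real.exp (b + e n) * (Real.exp (-(4 * μ * n) + ∑ i ∈ Finset.range n, e i) *
          (r * Real.exp (-(b + 2 * μ + K)))) := by
          gcongr
          exact hn.trans (by gcongr)
      _ = r * Real.exp ((b + e n) + (-(4 * μ * n) + ∑ i ∈ Finset.range n, e i) +
          -(b + 2 * μ + K)) := by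
        rw [Real.exp_add (b + e n + _), Real.exp_add (b + e n)]; ring
      _ ≤ _ := by
        gcongr
        linarith
  have hlt : ∀ n : ℕ, r * Real.exp (-(2 * μ * n)) ≤ r₀ := fun n =>
    (mul_le_of_le_one_right hr (Real.exp_le_one_iff.2 (by
      have : 0 ≤ 2 * μ * n := by positivity
      linarith))).trans hrr
  have hgrow : ∀ n, ‖y (n * N)‖ ≤
      Real.exp (-(4 * μ * n) + ∑ i ∈ Finset.range n, e i) * ‖y 0‖ := by
    intro n
    induction n with
    | zero => simp
    | succ n ih =>
      have h1 := (hblock n ((hkey n ih).trans (hlt n))).2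
      rw [Nat.succ_mul, Finset.sum_range_succ]
      calc _ ≤ Real.exp (-(4 * μ) + e n) *
            (Real.exp (-(4 * μ * n) + ∑ i ∈ Finset.range n, e i) * ‖y 0‖) :=
            h1.trans (by gcongr)
        _ = _ := by
          rw [← mul_assoc, ← Real.exp_add]
          congr 2
          push_cast
          ring
  intro j hj
  have h1 := hkey n (hgrow n)
  exact ((hblock n (h1.trans (hlt n))).1 j hj).trans h1

/-- Each block is charged to the interval preceding it, so the sum starts at the negative time `-h`.
-/
lemma sum_flowInt_mul (q : PathSpace m α → ℝ≥0∞) (ω : PathSpace m α) {h : ℝ} (hh : 0 ≤ h)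
    (n : ℕ) : ∑ i ∈ Finset.range n, flowInt q ω ((i - 1) * h) (i * h) =
      flowInt q ω (-h) ((n - 1) * h) := by
  induction n with
  | zero => simp [flowInt]
  | succ n ih =>
    have h1 : 0 ≤ (n : ℝ) * h := by positivity
    rw [Finset.sum_range_succ, ih, ← flowInt_add ω (by linarith) (by linarith)]
    push_cast
    congr 1
    ring

/-- Some value is at most the average; dividing by a length of at least one half gives the factor
two. -/
lemma exists_le_flowInt (hα : 0 < α) {q : PathSpace m α → ℝ≥0∞} (hq : Measurable q)
    (ω : PathSpace m α) {a h : ℝ} (hh : 1 / 2 ≤ h) :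
    ∃ v ∈ Ioc a (a + h), q (shift v ω) ≤ 2 * flowInt q ω a (a + h) := by
  have hvol : (volume : Measure ℝ) (Ioc a (a + h)) = ENNReal.ofReal h := by simp
  have hpos : 0 < ENNReal.ofReal h := ENNReal.ofReal_pos.2 (by linarith)
  have hmeas : Measurable fun v => q (shift v ω) :=
    (hq.comp (measurable_shift_uncurry hα)).comp (measurable_id.prodMk measurable_const)
  obtain ⟨v, hv, hle⟩ := exists_le_setLAverage (μ := volume) (s := Ioc a (a + h))
    (f := fun v => q (shift v ω)) (by rw [hvol]; exact hpos.ne')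
    (by rw [hvol]; exact ENNReal.ofReal_ne_top) hmeas.aemeasurable
  refine ⟨v, hv, hle.trans ?_⟩
  rw [setLAverage_eq, hvol, ENNReal.div_eq_inv_mul]
  unfold flowInt
  gcongr
  rw [ENNReal.inv_le_iff_inv_le]
  calc (2 : ℝ≥0∞)⁻¹ = ENNReal.ofReal (1 / 2) := by
        rw [one_div, ENNReal.ofReal_inv_of_pos two_pos]; simp
    _ ≤ _ := ENNReal.ofReal_le_ofReal hh

/-- The orbit of the scheme. -/
noncomputable def orbit (ε₀ : ℝ) (f : Vec d → Vec d) (g : Vec d → Vec m →L[ℝ] Vec d) (Δ : ℝ)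
    (ω : PathSpace m α) (y₀ : Vec d) : ℕ → Vec d
  | 0 => y₀
  | k + 1 => step ε₀ f g ω (k * Δ) ((k + 1 : ℕ) * Δ) (orbit ε₀ f g Δ ω y₀ k)

/-- If the linearized scheme contracts on average over blocks of `2 ^ k` steps, then small
solutions of the nonlinear scheme decay exponentially. -/
theorem exists_decay (hα : 0 < α) (hα2 : α ≤ 1 / 2) {ν κ : ℝ} (hκ : 0 < κ)
    {P : Measure (PathSpace m α)} (hP : NoiseHyp ν P) (hfinP : ∫⁻ ω, dyadicControl κ ω 0 2 ∂P < ∞)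
    {ε₀ : ℝ} (hε₀ : 0 < ε₀) {f : Vec d → Vec d} {g : Vec d → Vec m →L[ℝ] Vec d}
    (hf : ContDiffOn ℝ 1 f (Metric.closedBall 0 ε₀)) (hg : DiffusionHyp ε₀ g) (hf0 : f 0 = 0)
    (hg0 : g 0 = 0) (hG : ‖fderiv ℝ g 0‖ ≤ 1) {Δ a η c μ : ℝ} {k : ℕ} (hΔ : 0 < Δ)
    (hΔ1 : Δ ≤ 1) (hk : 2 ^ k * Δ ≤ 1) (hk' : 1 / 2 ≤ 2 ^ k * Δ)
    (hA : ‖1 + Δ • fderiv ℝ f 0‖ ≤ 1) (ha : 0 ≤ a) (hη : 0 < η) (hc : 0 < c) (hμ : 0 < μ)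
    (haμ : 4 * μ ≤ a - 2 * η)
    (hcμ : ENNReal.ofReal c * (1 + ∫⁻ ω, dyadicControl κ ω 0 2 ∂P) ≤ ENNReal.ofReal (μ / 2))
    (hlin : ∀ (ω : PathSpace m α) (s : ℝ), 0 ≤ s → s + 2 ^ k * Δ ≤ 2 → dyadicControl κ ω 0 2 ≠ ∞ →
      ‖dyadicProd (linStep (fderiv ℝ g 0) (fderiv ℝ f 0) ω Δ) Δ k s‖ ≤
        Real.exp (-a + η + c * (1 + (dyadicControl κ ω 0 2).toReal))) :
    ∃ (r₀ : ℝ) (K : PathSpace m α → ℝ), 0 < r₀ ∧ r₀ ≤ ε₀ ∧ Measurable K ∧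
      ∀ᵐ ω ∂P, ∀ r, 0 ≤ r → r ≤ r₀ → ∀ y₀ : Vec d, ‖y₀‖ ≤ r * Real.exp (-K ω) →
        ∀ i : ℕ, ‖orbit ε₀ f g Δ ω y₀ i‖ ≤ r ∧
          ‖orbit ε₀ f g Δ ω y₀ i‖ ≤ r * (Real.exp (2 * μ) * Real.exp (-(2 * μ) * (i * Δ))) := by
  have := hP.prob
  obtain ⟨C, hC, hblock⟩ := exists_block_bound (m := m) (d := d) hα hα2 hκ k
  obtain ⟨R, hR⟩ := lintegral_growthRate_lt (measurable_control (m := m) (α := α) κ 0 2) hfinP hμ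
    hcμ (C + a + 1)
  set D := Real.exp (-a + 2 * η) - Real.exp (-a + η) with hD
  have hD0 : 0 < D := sub_pos.2 (Real.exp_lt_exp.2 (by linarith))
  -- The order of choices matters: `C` is fixed by `k`, then `R` by the tail of the control, then
  -- `ρ` by `R`, and finally the radius `r₀` by `ρ`.
  set ρ := min 1 (D / Real.exp (C * (1 + R))) with hρ
  have hρ0 : 0 < ρ := lt_min one_pos (by positivity)
  have hρ1 : ρ ≤ 1 := min_le_left _ _
  have hρD : ρ * Real.exp (C * (1 + R)) ≤ D := by
    rw [← le_div_iff₀ (Real.exp_pos _)]; exact min_le_right _ _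
  obtain ⟨r₀, hr₀, hr₀ε, hlinb⟩ := exists_linearizationBound hε₀ hf hg hf0 hg0 hρ0
  set q : PathSpace m α → ℝ≥0∞ := fun ω => growthRate c (C + a + 1) R (dyadicControl κ ω 0 2)
    with hq
  have hqm : Measurable q := (measurable_growthRate _ _ _).comp (measurable_control κ 0 2)
  -- The best constant in the linear growth bound, written as a countable supremum so that it is a
  -- random variable.
  set S : PathSpace m α → ℝ≥0∞ := fun ω => ⨆ n : ℕ, (flowInt q ω (-1) n - ENNReal.ofReal (μ * n))
    with hS
  have hSm : Measurable S := Measurable.iSup fun n => (measurable_flowInt hα hqm _ _).sub_const _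
  refine ⟨r₀, fun ω => C * (1 + R) + 2 * μ + 2 * (S ω).toReal, hr₀, hr₀ε,
    (hSm.ennreal_toReal.const_mul 2).const_add _, ?_⟩
  filter_upwards [ae_flowInt_le hα hP hqm hμ hR] with ω hω r hr hrr₀ y₀ hy₀
  obtain ⟨K, hK⟩ := hω 1
  set h := 2 ^ k * Δ with hh
  have hh0 : 0 ≤ h := by linarith
  have hSfin : S ω ≠ ∞ := by
    refine ne_top_of_le_ne_top (ENNReal.natCast_ne_top K) (iSup_le fun n => ?_)
    rw [tsub_le_iff_right]
    simpa using hK n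
  have hflow : ∀ n : ℕ, flowInt q ω (-1) n ≤ S ω + ENNReal.ofReal (μ * n) := fun n => by
    rw [← tsub_le_iff_right]
    exact le_iSup (fun n : ℕ => flowInt q ω (-1) n - ENNReal.ofReal (μ * n)) n
  have hflowfin : ∀ n : ℕ, flowInt q ω (-1) n ≠ ∞ := fun n =>
    ne_top_of_le_ne_top (by finiteness) (hflow n)
  have hle : ∀ n : ℕ, ((n : ℝ) - 1) * h ≤ n := fun n => by
    have : (n : ℝ) * h ≤ n * 1 := by gcongr
    linarith
  have hFfin : ∀ n : ℕ, flowInt q ω ((n - 1) * h) (n * h) ≠ ∞ := fun n => by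
    refine ne_top_of_le_ne_top (hflowfin n) (flowInt_mono ω ?_ ?_)
    · have : 0 ≤ (n : ℝ) * h := by positivity
      linarith
    · have : (n : ℝ) * h ≤ n * 1 := by gcongr
      linarith
  set e : ℕ → ℝ := fun n => 2 * (flowInt q ω ((n - 1) * h) (n * h)).toReal with he
  have hsum : ∀ n, ∑ i ∈ Finset.range n, e i ≤ 2 * (S ω).toReal + 2 * μ * n := by
    intro n
    have h1 : ∑ i ∈ Finset.range n, e i = 2 * (flowInt q ω (-h) ((n - 1) * h)).toReal := by
      rw [← sum_flowInt_mul q ω hh0 n, ENNReal.toReal_sum fun i _ => hFfin i, Finset.mul_sum]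
    have h2 : flowInt q ω (-h) ((n - 1) * h) ≤ S ω + ENNReal.ofReal (μ * n) :=
      (flowInt_mono ω (by linarith) (hle n)).trans (hflow n)
    have h3 := ENNReal.toReal_mono (by finiteness) h2
    rw [ENNReal.toReal_add hSfin (by finiteness), ENNReal.toReal_ofReal (by positivity)] at h3
    rw [h1]
    linarith
  set y := orbit ε₀ f g Δ ω y₀ with hy
  have hysucc : ∀ j, y (j + 1) = step ε₀ f g ω (j * Δ) ((j + 1 : ℕ) * Δ) (y j) := fun j => rfl
  have hblk : ∀ n, Real.exp (C * (1 + R) + e n) * ‖y (n * 2 ^ k)‖ ≤ r₀ →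
      (∀ j ≤ 2 ^ k, ‖y (n * 2 ^ k + j)‖ ≤ Real.exp (C * (1 + R) + e n) * ‖y (n * 2 ^ k)‖) ∧
      ‖y (n * 2 ^ k + 2 ^ k)‖ ≤ Real.exp (-(4 * μ) + e n) * ‖y (n * 2 ^ k)‖ := by
    intro n hn
    -- Seen from time `v`, the block starts at `s = n h - v`, between `0` and `h`, and ends before
    -- `2 h ≤ 2`. The control of the shifted path on `[0, 2]` therefore covers it.
    obtain ⟨v, hv, hqv⟩ := exists_le_flowInt hα hqm ω (a := ((n : ℝ) - 1) * h) hk'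
    rw [show ((n : ℝ) - 1) * h + h = n * h by ring] at hv hqv
    have hq_top : q (shift v ω) ≠ ∞ :=
      ne_top_of_le_ne_top (ENNReal.mul_ne_top (by simp) (hFfin n)) hqv
    have hw : dyadicControl κ (shift v ω) 0 2 ≠ ∞ := ne_top_of_growthRate_ne_top hc hq_top
    have hqe : (growthRate c (C + a + 1) R (dyadicControl κ (shift v ω) 0 2)).toReal ≤ e n := by
      have := ENNReal.toReal_mono (ENNReal.mul_ne_top (by simp) (hFfin n)) hqv
      simpa [ENNReal.toReal_mul] using this
    set s := n * h - v with hs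
    have hs0 : 0 ≤ s := sub_nonneg.2 hv.2
    have hs2 : s + 2 ^ k * Δ ≤ 2 := by
      have := hv.1
      rw [← hh, hs]
      linarith
    have hexp1 := exp_le_exp_growthRate (R := R) hw ha hc.le hC.le
    have hexp2 := exp_add_le_exp_growthRate (R := R) hw ha hη hc.le hρ0.le hρ1 hC.le hρD
    have hexp1' : Real.exp (C * (1 + (dyadicControl κ (shift v ω) 0 2).toReal)) ≤
        Real.exp (C * (1 + R) + e n) := hexp1.trans (Real.exp_le_exp.2 (by linarith))
    have hb := hblock ε₀ f g (shift v ω) Δ s ρ r₀ (fun j => y (n * 2 ^ k + j)) hw hs0 hΔ hΔ1 hs2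
      hA hG hρ0.le hρ1 hlinb
      (by
        intro j _
        rw [← add_assoc, hysucc, step_shift]
        congr 1
        · rw [hs, hh]; push_cast; ring
        · rw [hs, hh]; push_cast; ring)
      (le_trans (by gcongr; simp) hn)
    refine ⟨fun j hj => (hb.1 j hj).trans (by gcongr; simp), hb.2.trans ?_⟩
    rw [add_zero]
    gcongr
    refine (add_le_add (hlin (shift v ω) s hs0 hs2 hw) le_rfl).trans
      (hexp2.trans (Real.exp_le_exp.2 ?_))
    linarith
  have hdecay := norm_le_of_block (y := y) (N := 2 ^ k) (e := e) hμ.le hr hrr₀ hblk hsum hy₀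
  intro i
  have hi := hdecay (i / 2 ^ k) (i % 2 ^ k) (Nat.mod_lt _ (by positivity)).le
  rw [Nat.div_add_mod'] at hi
  refine ⟨hi.trans (mul_le_of_le_one_right hr (Real.exp_le_one_iff.2 ?_)), hi.trans ?_⟩
  · have : 0 ≤ 2 * μ * ((i / 2 ^ k : ℕ) : ℝ) := by positivity
    linarith
  · rw [← Real.exp_add]
    gcongr
    -- A block has length at most one, so `i Δ` is at most the block index plus one; this costs the
    -- prefactor `exp (2 μ)`.
    have h1 : (i : ℝ) ≤ (((i / 2 ^ k : ℕ) : ℝ) + 1) * 2 ^ k := by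
      have := (Nat.lt_div_mul_add (a := i) (b := 2 ^ k) (by positivity)).le
      have h2 : (i : ℝ) ≤ ((i / 2 ^ k : ℕ) : ℝ) * 2 ^ k + 2 ^ k := by exact_mod_cast this
      linarith
    have h2 : (i : ℝ) * Δ ≤ ((i / 2 ^ k : ℕ) : ℝ) + 1 := by
      calc (i : ℝ) * Δ ≤ (((i / 2 ^ k : ℕ) : ℝ) + 1) * 2 ^ k * Δ := by gcongr
        _ = (((i / 2 ^ k : ℕ) : ℝ) + 1) * (2 ^ k * Δ) := by ring
        _ ≤ (((i / 2 ^ k : ℕ) : ℝ) + 1) * 1 := by gcongr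
        _ = _ := mul_one _
    nlinarith

/-! ### Choice of the constants and conclusion -/

lemma exists_two_pow_mul_mem {Δ : ℝ} (hΔ : 0 < Δ) (hΔ1 : Δ ≤ 1) :
    ∃ k : ℕ, 2 ^ k * Δ ≤ 1 ∧ 1 / 2 ≤ 2 ^ k * Δ := by
  obtain ⟨k, h1, h2⟩ := exists_nat_pow_near (one_le_one_div hΔ hΔ1) one_lt_two
  rw [le_div_iff₀ hΔ] at h1
  rw [div_lt_iff₀ hΔ, pow_succ] at h2
  exact ⟨k, h1, by linarith⟩

/-- Stability applies the decay bound at radius `min r₀ (ε / 2)`, whose second entry keeps the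
supremum strictly below `ε`; exponential decay applies it at `r₀`. -/
lemma isExpStable_of_decay {P : Measure (PathSpace m α)} {ε₀ r₀ Δ μ B : ℝ} {f : Vec d → Vec d}
    {g : Vec d → Vec m →L[ℝ] Vec d} {K : PathSpace m α → ℝ} (hr₀ : 0 < r₀) (hr₀ε : r₀ ≤ ε₀)
    (hK : Measurable K) (hμ : 0 < μ) (hB : 0 < B)
    (h : ∀ᵐ ω ∂P, ∀ r, 0 ≤ r → r ≤ r₀ → ∀ y₀ : Vec d, ‖y₀‖ ≤ r * Real.exp (-K ω) →
        ∀ i : ℕ, ‖orbit ε₀ f g Δ ω y₀ i‖ ≤ r ∧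
          ‖orbit ε₀ f g Δ ω y₀ i‖ ≤ r * (B * Real.exp (-μ * (i * Δ)))) :
    IsExpStable P ε₀ f g Δ (fun _ _ => 0) := by
  have hmeas : ∀ r : ℝ, Measurable fun ω => r * Real.exp (-K ω) := fun r =>
    (Real.measurable_exp.comp hK.neg).const_mul r
  refine ⟨fun ε hε => ?_, fun ω => r₀ * Real.exp (-K ω), fun _ => r₀ * B, μ, hmeas r₀,
    measurable_const, fun ω => by positivity, fun ω => by positivity, hμ, ?_⟩
  · have hmin : 0 < min r₀ (ε / 2) := lt_min hr₀ (by linarith)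
    refine ⟨fun ω => min r₀ (ε / 2) * Real.exp (-K ω), hmeas _, fun ω => by positivity, ?_⟩
    filter_upwards [h] with ω hω y₀ hy₀
    rw [sub_zero] at hy₀
    have h1 := hω _ hmin.le (min_le_left _ _) y₀ hy₀.le
    refine ⟨orbit ε₀ f g Δ ω y₀, ⟨rfl, fun i => ?_, fun i => rfl⟩, ε / 2, by linarith,
      fun i => ?_⟩
    · rw [mem_closedBall_zero_iff]
      exact (h1 i).1.trans ((min_le_left _ _).trans hr₀ε)
    · rw [sub_zero]
      exact (h1 i).1.trans (min_le_right _ _)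
  · filter_upwards [h] with ω hω y₀ hy₀
    rw [sub_zero] at hy₀
    have h1 := hω _ hr₀.le le_rfl y₀ hy₀.le
    refine ⟨orbit ε₀ f g Δ ω y₀, ⟨rfl, fun i => ?_, fun i => rfl⟩, fun i => ?_⟩
    · rw [mem_closedBall_zero_iff]
      exact (h1 i).1.trans hr₀ε
    · rw [sub_zero]
      exact (h1 i).2.trans (le_of_eq (by ring))

/-- Almost sure exponential stability of the rough Euler scheme under small noise. -/
theorem exists_isExpStable {f : Vec d → Vec d} (hf0 : f 0 = 0) {lam : ℝ} (hlam : 0 < lam)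
    (hneg : ∀ y : Vec d, inner ℝ y (fderiv ℝ f 0 y) ≤ -lam * ‖y‖ ^ 2) :
    ∃ Δ₀ : ℝ, 0 < Δ₀ ∧
      ∀ (m : ℕ) (ν α : ℝ), 1 / 3 < α → α < ν → ν ≤ 1 / 2 →
      ∀ P : Measure (PathSpace m α), NoiseHyp ν P →
      ∃ C₀ : ℝ, 0 < C₀ ∧
        ∀ ε₀ : ℝ, 0 < ε₀ → DriftHyp ε₀ f →
        ∀ g : Vec d → Vec m →L[ℝ] Vec d,
          DiffusionHyp ε₀ g → g 0 = 0 → ‖fderiv ℝ g 0‖ < C₀ →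
        ∀ Δ : ℝ, 0 < Δ → Δ < Δ₀ →
          IsExpStable P ε₀ f g Δ (fun _ _ => 0) := by
  set A := fderiv ℝ f 0 with hA
  set L := ‖A‖ with hL
  have hL0 : 0 ≤ L := norm_nonneg A
  refine ⟨min 1 (lam / (L ^ 2 + 1)), by positivity, ?_⟩
  intro m ν α hα hαν hν P hP
  have hα0 : 0 < α := by linarith
  set β := 1 / α * ν - 1 with hβ
  have hβ0 : 0 < β := by
    rw [hβ, one_div, ← div_eq_inv_mul, sub_pos, one_lt_div hα0]; exact hαν
  -- `κ < β` keeps the mean of the control finite, and `κ ≤ 1/2` serves the drift-noise cross terms.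
  set κ := min (1 / 2) (β / 2) with hκ
  have hκ0 : 0 < κ := by positivity
  have hfinP := lintegral_control_lt_top hP (show κ < 1 / α * ν - 1 by
    have := min_le_right (1 / 2) (β / 2); linarith)
  set E := ∫⁻ ω, dyadicControl κ ω 0 2 ∂P with hE
  obtain ⟨K, hK, hlin⟩ := linear_block_bound (m := m) (d := d) hα (by linarith) hκ0
    (min_le_left _ _) hL0 (show 0 ≤ lam / 4 by positivity) (show 0 < lam / 16 by positivity)
  have hE0 : 0 ≤ E.toReal := ENNReal.toReal_nonneg
  -- Chosen so that `K δ (1 + E w) ≤ μ / 2` with `μ = λ / 32`; only `f` and the law of the noise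
  -- enter.
  set δ := min 1 (lam / 64 / (K * (1 + E.toReal))) with hδ
  have hδ0 : 0 < δ := by positivity
  have hδ1 : δ ≤ 1 := min_le_left _ _
  have hδE : K * δ * (1 + E.toReal) ≤ lam / 64 := by
    have h1 : δ ≤ lam / 64 / (K * (1 + E.toReal)) := min_le_right _ _
    rw [le_div_iff₀ (by positivity)] at h1
    linarith
  refine ⟨δ ^ 2, by positivity, ?_⟩
  intro ε₀ hε₀ hfd g hg hg0 hG Δ hΔ hΔ₀
  have hΔ1 : Δ ≤ 1 := hΔ₀.le.trans (min_le_left _ _)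
  have hΔL : Δ * L ^ 2 ≤ lam := by
    have h1 := hΔ₀.le.trans (min_le_right _ _)
    rw [le_div_iff₀ (by positivity)] at h1
    linarith
  obtain ⟨k, hk, hk'⟩ := exists_two_pow_mul_mem hΔ hΔ1
  have hS := norm_one_add_smul_le (A := A) le_rfl hneg hΔ.le hΔL
  have hS1 : ‖1 + Δ • A‖ ≤ 1 := hS.trans (Real.exp_le_one_iff.2 (by
    have : 0 ≤ lam / 2 * Δ := by positivity
    linarith))
  have hSk : ‖(1 + Δ • A) ^ 2 ^ k‖ ≤ Real.exp (-(lam / 4)) := by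
    calc ‖(1 + Δ • A) ^ 2 ^ k‖ ≤ ‖1 + Δ • A‖ ^ 2 ^ k := norm_pow_le' _ (by positivity)
      _ ≤ Real.exp (-(lam / 2 * Δ)) ^ 2 ^ k := by gcongr
      _ = Real.exp (-(lam / 2 * (2 ^ k * Δ))) := by
        rw [← Real.exp_nat_mul]; congr 1; push_cast; ring
      _ ≤ _ := by
        gcongr
        nlinarith
  -- `a = λ / 4` is the rate `λ / 2` over a block of length at least one half, and the remaining
  -- values balance `4 μ = a - 2 η`.
  obtain ⟨r₀, Kω, hr₀, hr₀ε, hKm, hdecay⟩ := exists_decay (a := lam / 4) (η := lam / 16)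
    (c := K * δ) (μ := lam / 32) hα0 (by linarith) hκ0 hP hfinP hε₀ hfd.contDiff hg hf0 hg0
    (hG.le.trans (pow_le_one₀ hδ0.le hδ1)) hΔ hΔ1 hk hk' hS1 (by positivity) (by positivity)
    (by positivity) (by positivity) (by linarith)
    (by
      rw [← hE, ← ENNReal.ofReal_toReal hfinP.ne, ← ENNReal.ofReal_one,
        ← ENNReal.ofReal_add zero_le_one hE0, ← ENNReal.ofReal_mul (by positivity)]
      exact ENNReal.ofReal_le_ofReal (by linarith))
    (fun ω s hs hs2 hfin => by
      have := hlin A (fderiv ℝ g 0) δ Δ k ω s le_rfl hδ0 hδ1 hG.le hΔ hk hS1 hSk hs hs2 hfin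
      rwa [← mul_assoc] at this)
  exact isExpStable_of_decay hr₀ hr₀ε hKm (by positivity) (Real.exp_pos _) hdecay

end RoughEuler

theorem mainTheorem4 (d : ℕ) (f : RoughEuler.Vec d → RoughEuler.Vec d) (hf0 : f 0 = 0)
    (hf : ∃ ε₀ : ℝ, 0 < ε₀ ∧ RoughEuler.DriftHyp ε₀ f) :
    ∃ Δ₀ : ℝ, 0 < Δ₀ ∧
      ∀ (m : ℕ) (ν α : ℝ), 1 / 3 < α → α < ν → ν ≤ 1 / 2 →
      ∀ P : MeasureTheory.Measure (RoughEuler.PathSpace m α), RoughEuler.NoiseHyp ν P →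
      ∃ C₀ : ℝ, 0 < C₀ ∧
        ∀ ε₀ : ℝ, 0 < ε₀ → RoughEuler.DriftHyp ε₀ f →
        ∀ g : RoughEuler.Vec d → RoughEuler.Vec m →L[ℝ] RoughEuler.Vec d,
          RoughEuler.DiffusionHyp ε₀ g → g 0 = 0 → ‖fderiv ℝ g 0‖ < C₀ →
        ∀ Δ : ℝ, 0 < Δ → Δ < Δ₀ →
          RoughEuler.IsExpStable P ε₀ f g Δ (fun _ _ => 0) := by
  -- The constant `λ` is a property of `Df(0)` alone, so `Δ₀` and `C₀` can be chosen before the ball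
  -- is.
  obtain ⟨-, -, -, lam, hlam, hneg⟩ := hf
  exact RoughEuler.exists_isExpStable hf0 hlam hneg
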